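/- Let $d\in\{2,3\}$, let $\Omega\subset\mathbb R^d$ be a bounded open polyhedral domain and let $\mathcal T$ be a finite subdivision of $\Omega$ into disjoint open polygonal/polyhedral elements $\kappa$ of diameter $h_\kappa$. Let $\mathcal E$ be the set of open $(d-1)$-dimensional simplicial faces of $\mathcal T$ (mesh interfaces and boundary facets, sub-triangulated if $d=3$; hanging nodes and edges are allowed). Each face is either an interior face, contained in $\Omega$ and shared by exactly two elements, or a boundary face, contained in $\partial\Omega$ and belonging to exactly one element. Write $\Gamma=\bigcup_{F\in\mathcal E}F$. Let $p_\kappa\in\{2,3\}$ for all $\kappa\in\mathcal T$, put $q_\kappa:=(p_\kappa+1)(p_\kappa+d)/h_\kappa$, let $S^{\mathbf p}_{\mathcal T}$ be the space of functions whose restriction to each $\kappa$ is a polynomial of total degree at most $p_\kappa$, let $\mathcal S:=H^2(\Omega)+S^{\mathbf p}_{\mathcal T}$, and let $\Pi$ be the $L_2(\Omega)$-orthogonal projection onto $S^{\mathbf p-2}_{\mathcal T}$. On an interior face shared by $\kappa_i,\kappa_j$, with outward unit normals $n_i,n_j$ and traces $v_i,v_j$ (resp. $w_i,w_j$ for vector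 fields) from inside $\kappa_i,\kappa_j$, let $\{v\}=\frac12(v_i+v_j)$, $[v]=v_in_i+v_jn_j$, $\{w\}=\frac12(w_i+w_j)$ and $[w]=w_i\cdot n_i+w_j\cdot n_j$; on a boundary face of $\kappa_i$ let $\{v\}=v_i$, $[v]=v_in_i$, $\{w\}=w_i$ and $[w]=w_i\cdot n_i$. In all formulas below, $\Delta$ and $\nabla$ are taken elementwise. Define facewise $$\sigma|_F=C_\sigma\{q^3\},\qquad \tau|_F=C_\tau\{q\},$$ where $\{\cdot\}$ is the average over the two adjacent elements on an interior face, and the value of the single adjacent element on a boundary face. For $u,v\in\mathcal S$ let $$\tilde B(u,v)=\sum_{\kappa\in\mathcal T}\int_\kappa\Delta u\,\Delta v\,dx+\int_\Gamma\big(\{\nabla\Pi(\Delta u)\}\cdot[v]+\{\nabla\Pi(\Delta v)\}\cdot[u]\big)ds-\int_\Gamma\big(\{\Pi(\Delta u)\}[\nabla v]+\{\Pi(\Delta v)\}[\nabla u]\big)ds+\int_\Gamma\big(\sigma[u]\cdot[v]+\tau[\nabla u][\nabla v]\big)ds,$$ $$\|v\|_{DG}^2=\sum_{\kappa\in\mathcal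 T}\|\Delta v\|_{L_2(\kappa)}^2+\int_\Gamma\big(\sigma|[v]|^2+\tau|[\nabla v]|^2\big)ds .$$ Assume, with constants $C_s>0$ and $\theta>1$: (i) (arbitrary number of faces) for every $\kappa\in\mathcal T$ there are pairwise non-overlapping $d$-simplices $\kappa_\flat^F\subset\kappa$, one for each face $F\subset\partial\kappa$ and having $F$ as one of its faces, such that $h_\kappa\le C_s\,d\,|\kappa_\flat^F|/|F|$; (ii) (bounded variation) $\theta^{-1}\le q_{\kappa_i}/q_{\kappa_j}\le\theta$ for all $\kappa_i,\kappa_j\in\mathcal T$ sharing a common face. Then there are positive constants $C_\sigma^0,C_\tau^0,C_{\rm coer},C_{\rm cont}$ depending only on $d$, $C_s$ and $\theta$ (hence independent of $\Omega$, of the local mesh sizes $h_\kappa$, of the degrees $p_\kappa\in\{2,3\}$, of the measures of the faces and of the number of faces) such that, whenever $C_\sigma\ge C_\sigma^0$ and $C_\tau\ge C_\tau^0$, $$\tilde B(v,v)\ge C_{\rm coer}\|v\|_{DG}^2\quad\text{for all }v\in\mathcal S,\qquad |\tilde B(w,v)|\le C_{\rm cont}\|w\|_{DG}\|v\|_{DG}\quad\text{for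 all }w,v\in\mathcal S .$$ -/

import Mathlib

open MeasureTheory Set Filter Topology
open scoped ContDiff MeasureTheory

noncomputable section

namespace DGBiharmonic

/-- The Euclidean space `ℝ^d`. -/
abbrev E (d : ℕ) : Type := EuclideanSpace ℝ (Fin d)

/-- The `j`-th coordinate vector of `ℝ^d`. -/
def coordVec {d : ℕ} (j : Fin d) : E d := EuclideanSpace.single j 1

/-! ### Weak derivatives and Sobolev spaces on open sets -/

/-- `g` is the weak partial derivative `∂u/∂x_j` on the open set `U`. -/
def HasWeakPartial {d : ℕ} (U : Set (E d)) (j : Fin d) (u g : E d → ℝ) : Prop :=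
  ∀ φ : E d → ℝ, ContDiff ℝ ∞ φ → HasCompactSupport φ → tsupport φ ⊆ U →
    (∫ x in U, u x * fderiv ℝ φ x (coordVec j)) = -(∫ x in U, g x * φ x)

/-- The Sobolev space `H²(U)`: `u`, its first and its second weak derivatives lie in `L₂(U)`. -/
def MemH2 {d : ℕ} (U : Set (E d)) (u : E d → ℝ) : Prop :=
  MemLp u 2 (volume.restrict U) ∧
  ∃ (G : Fin d → E d → ℝ) (H : Fin d → Fin d → E d → ℝ),
    (∀ i, MemLp (G i) 2 (volume.restrict U) ∧ HasWeakPartial U i u (G i)) ∧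
    (∀ i j, MemLp (H i j) 2 (volume.restrict U) ∧ HasWeakPartial U j (G i) (H i j))

open Classical in
/-- The weak partial derivative `∂u/∂x_j ∈ L₂(U)` (unique up to null sets of `U`; `0` if `u` has no
weak partial derivative in `L₂(U)`). -/
def weakPartial {d : ℕ} (U : Set (E d)) (j : Fin d) (u : E d → ℝ) : E d → ℝ :=
  if h : ∃ g : E d → ℝ, MemLp g 2 (volume.restrict U) ∧ HasWeakPartial U j u g then h.choose else 0

/-- The weak Laplacian on the open set `U`. -/
def weakLaplacian {d : ℕ} (U : Set (E d)) (u : E d → ℝ) : E d → ℝ := fun x =>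
  ∑ j, weakPartial U j (weakPartial U j u) x

/-! ### Polytopic meshes -/

/-- The unit vector `n` is normal to the `(d-1)`-simplex `F`, and `κ` lies locally on one side of
`F`, namely on the side opposite to `n`. -/
def IsOutwardNormal {d : ℕ} (κ : Set (E d)) (F : Affine.Simplex ℝ (E d) (d - 1)) (n : E d) : Prop :=
  ‖n‖ = 1 ∧
  (∀ a b, inner ℝ (F.points a - F.points b) n = 0) ∧
  ∀ x ∈ F.interior, ∀ᶠ t : ℝ in 𝓝[>] 0, x - t • n ∈ κ ∧ x + t • n ∉ closure κ

/-- A subdivision of a bounded open polyhedral set `domain` of `ℝ^d` into disjoint open polytopic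
elements `elem i`, with the set `face f` of its `(d-1)`-simplicial faces: the mesh interfaces and the
boundary facets, sub-triangulated for `d = 3`.  Hanging nodes and edges are allowed, and elements need
not be convex.  A face `f` belongs to the element `i` if it is contained in the boundary of `elem i`.
`Affine.Simplex.interior` is the relatively open simplex and `Affine.Simplex.closedInterior` the
closed one. -/
structure PolytopicMesh (d : ℕ) where
  domain : Set (E d)
  numElems : ℕ
  elem : Fin numElems → Set (E d)
  numFaces : ℕ
  face : Fin numFaces → Affine.Simplex ℝ (E d) (d - 1)
  isOpen_domain : IsOpen domain
  isBounded_domain : Bornology.IsBounded domain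
  isOpen_elem : ∀ i, IsOpen (elem i)
  nonempty_elem : ∀ i, (elem i).Nonempty
  elem_subset : ∀ i, elem i ⊆ domain
  disjoint_elem : ∀ i j, i ≠ j → Disjoint (elem i) (elem j)
  closure_domain : closure domain = ⋃ i, closure (elem i)
  disjoint_face : ∀ f g, f ≠ g → Disjoint (face f).interior (face g).interior
  /-- The boundary of an element is the union of the (closed) faces of the element. -/
  frontier_elem : ∀ i, frontier (elem i) =
    ⋃ f ∈ {f | (face f).closedInterior ⊆ frontier (elem i)}, (face f).closedInterior
  /-- The boundary of the domain is the union of the (closed) boundary faces. -/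
  frontier_domain : frontier domain =
    ⋃ f ∈ {f | (face f).interior ⊆ frontier domain}, (face f).closedInterior
  exists_outwardNormal : ∀ i f, (face f).closedInterior ⊆ frontier (elem i) →
    ∃ n, IsOutwardNormal (elem i) (face f) n
  /-- A face is either an interior face, shared by exactly two elements, or a boundary face,
  belonging to exactly one element. -/
  interior_or_boundary : ∀ f,
    ((face f).interior ⊆ domain ∧
      ∃ i j, i ≠ j ∧ ∀ k, (face f).closedInterior ⊆ frontier (elem k) ↔ k = i ∨ k = j) ∨
    ((face f).interior ⊆ frontier domain ∧
      ∃ i, ∀ k, (face f).closedInterior ⊆ frontier (elem k) ↔ k = i)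

namespace PolytopicMesh

variable {d : ℕ} (M : PolytopicMesh d)

/-- The face `f` is contained in the boundary of the element `i`. -/
def IsFaceOf (f : Fin M.numFaces) (i : Fin M.numElems) : Prop :=
  (M.face f).closedInterior ⊆ frontier (M.elem i)

open Classical in
/-- The faces of the element `i`. -/
def facesOf (i : Fin M.numElems) : Finset (Fin M.numFaces) :=
  Finset.univ.filter fun f => M.IsFaceOf f i

open Classical in
/-- The elements that have `f` as a face: two for an interior face, one for a boundary face. -/
def adj (f : Fin M.numFaces) : Finset (Fin M.numElems) :=
  Finset.univ.filter fun i => M.IsFaceOf f i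

/-- The surface measure on the open face `f`, i.e. the normalised `(d-1)`-dimensional Hausdorff
measure restricted to it. -/
def faceMeasure (f : Fin M.numFaces) : Measure (E d) :=
  (μHE[d - 1] : Measure (E d)).restrict (M.face f).interior

/-- `|F|`. -/
def faceArea (f : Fin M.numFaces) : ℝ :=
  (μHE[d - 1] : Measure (E d)).real (M.face f).interior

open Classical in
/-- The outward unit normal vector of the element `i` on its face `f`. -/
def normal (i : Fin M.numElems) (f : Fin M.numFaces) : E d :=
  if h : ∃ n, IsOutwardNormal (M.elem i) (M.face f) n then h.choose else 0

/-- The diameter `h_κ`. -/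
def h (i : Fin M.numElems) : ℝ := Metric.diam (M.elem i)

/-- The quantity `(p_κ + 1) (p_κ + d) / h_κ`. -/
def ratio (p : Fin M.numElems → ℕ) (i : Fin M.numElems) : ℝ :=
  ((p i : ℝ) + 1) * ((p i : ℝ) + d) / M.h i

/-! ### Mesh assumptions -/

/-- The mesh assumption for arbitrary number of faces: for every element `κ` there is a family of
non-overlapping `d`-simplices `T f ⊆ κ`, one for each face `f` of `κ` and having `f` as one of its
faces, with `h_κ ≤ C_s d |T f| / |f|`. -/
def ArbitraryFaces (Cs : ℝ) : Prop :=
  ∀ i, ∃ T : Fin M.numFaces → Affine.Simplex ℝ (E d) d,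
    (∀ f ∈ M.facesOf i,
      (T f).interior ⊆ M.elem i ∧
      range (M.face f).points ⊆ range (T f).points ∧
      M.h i ≤ Cs * (d * volume.real (T f).interior / M.faceArea f)) ∧
    ∀ f ∈ M.facesOf i, ∀ g ∈ M.facesOf i, f ≠ g → Disjoint (T f).interior (T g).interior

/-- The bounded variation assumption on `(p_κ + 1) (p_κ + d) / h_κ` across common faces. -/
def BoundedVariation (p : Fin M.numElems → ℕ) (θ : ℝ) : Prop :=
  ∀ i j, i ≠ j → (∃ f, M.IsFaceOf f i ∧ M.IsFaceOf f j) →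
    θ⁻¹ ≤ M.ratio p i / M.ratio p j ∧ M.ratio p i / M.ratio p j ≤ θ

/-! ### The finite element space and the space `H²(Ω) + S_T^p` -/

/-- The piecewise polynomial function that equals `P i` on the element `i`. -/
def piecewise (P : Fin M.numElems → MvPolynomial (Fin d) ℝ) : E d → ℝ := fun x =>
  ∑ i, (M.elem i).indicator (fun y => MvPolynomial.eval (fun j => y j) (P i)) x

/-- The polynomial `P i` has total degree at most `k i`, for every element `i`. -/
def DegreeLE (k : Fin M.numElems → ℕ) (P : Fin M.numElems → MvPolynomial (Fin d) ℝ) : Prop :=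
  ∀ i, P i ∈ MvPolynomial.restrictTotalDegree (Fin d) ℝ (k i)

/-- The space `H²(Ω) + S_T^p` (its members are regarded as functions on `Ω` up to null sets). -/
def dgSpace (p : Fin M.numElems → ℕ) : Set (E d → ℝ) :=
  {v | ∃ (u : E d → ℝ) (P : Fin M.numElems → MvPolynomial (Fin d) ℝ),
    MemH2 M.domain u ∧ M.DegreeLE p P ∧
    v =ᵐ[volume.restrict M.domain] fun x => u x + M.piecewise P x}

/-- The elementwise (broken) Laplacian. -/
def brokenLaplacian (v : E d → ℝ) : E d → ℝ := fun x =>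
  ∑ i, (M.elem i).indicator (weakLaplacian (M.elem i) v) x

/-- `P` is the `L₂(Ω)`-projection of `w` onto `S_T^k`. -/
def IsL2Proj (k : Fin M.numElems → ℕ) (w : E d → ℝ)
    (P : Fin M.numElems → MvPolynomial (Fin d) ℝ) : Prop :=
  M.DegreeLE k P ∧ ∀ Q, M.DegreeLE k Q →
    (∫ x in M.domain, (w x - M.piecewise P x) * M.piecewise Q x) = 0

open Classical in
/-- The `L₂(Ω)`-projection of `w ∈ L₂(Ω)` onto `S_T^k`, as a family of polynomials. -/
def l2Proj (k : Fin M.numElems → ℕ) (w : E d → ℝ) : Fin M.numElems → MvPolynomial (Fin d) ℝ :=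
  if h : ∃ P, M.IsL2Proj k w P then h.choose else 0

/-- The polynomials of `Π(Δv)`, with `Π` the `L₂(Ω)`-projection onto `S_T^(p-2)`. -/
def projLaplacian (p : Fin M.numElems → ℕ) (v : E d → ℝ) :
    Fin M.numElems → MvPolynomial (Fin d) ℝ :=
  M.l2Proj (fun i => p i - 2) (M.brokenLaplacian v)

/-! ### Traces, jumps and averages -/

/-- `g ∈ L₂(∂κ)` is the trace on `∂κ`, taken from inside the element `κ`, of the function
`v ∈ H¹(κ)`: Green's formula
`∫_κ (v div φ + ∇v · φ) = ∫_{∂κ} g φ · n` holds for all smooth vector fields `φ`. -/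
def IsTrace (i : Fin M.numElems) (v g : E d → ℝ) : Prop :=
  (∀ f ∈ M.facesOf i, MemLp g 2 (M.faceMeasure f)) ∧
  ∀ φ : E d → E d, ContDiff ℝ ∞ φ → HasCompactSupport φ →
    (∫ x in M.elem i, (v x * (∑ j, (fderiv ℝ φ x (coordVec j)) j)
        + (∑ j, weakPartial (M.elem i) j v x * φ x j)))
      = ∑ f ∈ M.facesOf i, ∫ x, g x * inner ℝ (φ x) (M.normal i f) ∂(M.faceMeasure f)

open Classical in
/-- The trace on `∂κ` of `v ∈ H¹(κ)` from inside the element `κ` (unique up to null sets of `∂κ`). -/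
def trace (i : Fin M.numElems) (v : E d → ℝ) : E d → ℝ :=
  if h : ∃ g, M.IsTrace i v g then h.choose else 0

/-- The trace on `∂κ` of `∇v`, for `v ∈ H²(κ)`, taken componentwise. -/
def gradTrace (i : Fin M.numElems) (v : E d → ℝ) : E d → E d := fun x =>
  WithLp.toLp 2 fun j => M.trace i (weakPartial (M.elem i) j v) x

/-- The average on the face `f` of the one-sided quantities `a i`: `(a i + a j) / 2` on a face shared
by the elements `i` and `j`, and `a i` on a boundary face. -/
def mean {V : Type} [AddCommGroup V] [Module ℝ V] (f : Fin M.numFaces)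
    (a : Fin M.numElems → V) : V :=
  ((M.adj f).card : ℝ)⁻¹ • ∑ i ∈ M.adj f, a i

/-- The jump `⟦v⟧ = v_i n_i + v_j n_j` (vector valued); `v_i n_i` on a boundary face. -/
def jump (f : Fin M.numFaces) (v : E d → ℝ) : E d → E d := fun x =>
  ∑ i ∈ M.adj f, M.trace i v x • M.normal i f

/-- The jump `⟦∇v⟧ = ∇v_i · n_i + ∇v_j · n_j` (scalar valued); `∇v_i · n_i` on a boundary face. -/
def gradJump (f : Fin M.numFaces) (v : E d → ℝ) : E d → ℝ := fun x =>
  ∑ i ∈ M.adj f, inner ℝ (M.gradTrace i v x) (M.normal i f)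

/-- The average on the face `f` of the piecewise polynomial function given by `P`. -/
def meanPoly (f : Fin M.numFaces) (P : Fin M.numElems → MvPolynomial (Fin d) ℝ) : E d → ℝ :=
  fun x => M.mean f fun i => MvPolynomial.eval (fun j => x j) (P i)

/-- The average on the face `f` of the gradient of the piecewise polynomial function given by `P`. -/
def meanGradPoly (f : Fin M.numFaces) (P : Fin M.numElems → MvPolynomial (Fin d) ℝ) : E d → E d :=
  fun x => M.mean f fun i =>
    (WithLp.toLp 2 fun l => MvPolynomial.eval (fun j => x j) (MvPolynomial.pderiv l (P i)) : E d)

/-! ### Penalty functions, bilinear form and norm -/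

/-- The facewise constant penalty function `σ`. -/
def sigma (p : Fin M.numElems → ℕ) (Cσ : ℝ) (f : Fin M.numFaces) : ℝ :=
  Cσ * M.mean f fun i => M.ratio p i ^ 3

/-- The facewise constant penalty function `τ`. -/
def tau (p : Fin M.numElems → ℕ) (Cτ : ℝ) (f : Fin M.numFaces) : ℝ :=
  Cτ * M.mean f fun i => M.ratio p i

/-- The inconsistent bilinear form `B̃(u, v)` with penalty functions `σ` and `τ`. -/
def Btilde (p : Fin M.numElems → ℕ) (σ τ : Fin M.numFaces → ℝ) (u v : E d → ℝ) : ℝ :=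
  (∑ i, ∫ x in M.elem i, weakLaplacian (M.elem i) u x * weakLaplacian (M.elem i) v x)
  + (∑ f, ∫ x, (inner ℝ (M.meanGradPoly f (M.projLaplacian p u) x) (M.jump f v x)
      + inner ℝ (M.meanGradPoly f (M.projLaplacian p v) x) (M.jump f u x)) ∂(M.faceMeasure f))
  - (∑ f, ∫ x, (M.meanPoly f (M.projLaplacian p u) x * M.gradJump f v x
      + M.meanPoly f (M.projLaplacian p v) x * M.gradJump f u x) ∂(M.faceMeasure f))
  + (∑ f, ∫ x, (σ f * inner ℝ (M.jump f u x) (M.jump f v x)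
      + τ f * (M.gradJump f u x * M.gradJump f v x)) ∂(M.faceMeasure f))

/-- The DG norm with penalty functions `σ` and `τ`. -/
def dgNorm (σ τ : Fin M.numFaces → ℝ) (v : E d → ℝ) : ℝ :=
  Real.sqrt ((∑ i, ∫ x in M.elem i, weakLaplacian (M.elem i) v x ^ 2)
    + (∑ f, ∫ x, (σ f * ‖M.jump f v x‖ ^ 2 + τ f * M.gradJump f v x ^ 2) ∂(M.faceMeasure f)))

end PolytopicMesh

end DGBiharmonic

end

namespace DGBiharmonic

/-! ### Simplices -/

/-! Since `p ≤ 3`, the projected Laplacian `Π(Δv)` is on each element `κ` an affine function `ℓ = c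
+ a · x`. By Young's inequality everything reduces to two inverse estimates for `ℓ` with constants
independent of the number and size of the faces: `h ∑ |F| max_F ℓ² ≤ C ∫_κ ℓ²` and `h³ ∑ |F| |a|² ≤
C ∫_κ ℓ²`.

For the first, `|ℓ|` attains its maximum `m_F` over a face at a vertex of `F`, which is also a
vertex of the simplex `κ_♭^F`. Where `|ℓ|` is small on that simplex, it is large at the midpoint
with this vertex, so `m_F² |κ_♭^F|` is bounded by the integral of `ℓ²` over the simplex
(`sq_mul_volume_le`). The simplices do not overlap, so the bounds add up
(`h_mul_sum_faceArea_mul_sq_le`).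

The second has to hold without any shape regularity of `κ`. From a point of `κ`, move along `a` or
`-a`, whichever makes `|ℓ|` grow; the boundary is reached on some face `F` within distance `m_F /
|a|`. Hence `κ` is covered by the faces swept over these distances, and `|a| |κ| ≤ C ∑ |F| m_F`
(`norm_mul_volume_elem_le`). Cauchy–Schwarz, the first estimate and `h ∑ |F| ≤ C |κ|` conclude
(`h_pow_mul_norm_sq_mul_sum_faceArea_le`).

As `Π` is an elementwise contraction and `h⁻¹ ≤ q`, the averages of `Π(Δv)` and of its gradient are
small relative to `‖Δv‖` in the norms weighted with `τ⁻¹` and `σ⁻¹` once the penalty constants are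
large. Coercivity and continuity follow by absorbing the face terms. -/

lemma lineMap_mem_simplex_interior {d n : ℕ} (S : Affine.Simplex ℝ (E d) n) {x y : E d}
    (hx : x ∈ S.interior) (hy : y ∈ S.closedInterior) {t : ℝ} (h0 : 0 < t) (h1 : t ≤ 1) :
    AffineMap.lineMap y x t ∈ S.interior := by
  obtain ⟨w, hw, hw01, rfl⟩ := hx
  obtain ⟨u, hu, hu01, rfl⟩ := hy
  have hsum : ∑ i, ((1 - t) * u i + t * w i) = 1 := by
    rw [Finset.sum_add_distrib, ← Finset.mul_sum, ← Finset.mul_sum, hu, hw]; ring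
  refine ⟨fun i => (1 - t) * u i + t * w i, hsum, fun i => ⟨?_, ?_⟩, ?_⟩
  · have := mul_nonneg (sub_nonneg.2 h1) (hu01 i).1
    have := mul_pos h0 (hw01 i).1
    linarith
  · have := mul_le_mul_of_nonneg_left (hu01 i).2 (sub_nonneg.2 h1)
    have := mul_lt_mul_of_pos_left (hw01 i).2 h0
    linarith
  · rw [Finset.affineCombination_eq_linear_combination _ _ _ hsum,
      Finset.affineCombination_eq_linear_combination _ _ _ hu,
      Finset.affineCombination_eq_linear_combination _ _ _ hw, AffineMap.lineMap_apply_module,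
      Finset.smul_sum, Finset.smul_sum, ← Finset.sum_add_distrib]
    exact Finset.sum_congr rfl fun i _ => by rw [add_smul, mul_smul, mul_smul]

lemma convex_simplex_interior {d n : ℕ} (S : Affine.Simplex ℝ (E d) n) :
    Convex ℝ S.interior := by
  rw [convex_iff_forall_pos]
  intro x hx y hy a b ha hb hab
  have := lineMap_mem_simplex_interior S hx (S.interior_subset_closedInterior hy) ha (by linarith)
  rw [AffineMap.lineMap_apply_module] at this
  rwa [add_comm, ← (by linarith : 1 - a = b)]

/-- The barycentre. Positivity of `n` matters: interior weights are strictly below `1`, so a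
`0`-simplex has empty `interior`. -/
lemma exists_mem_simplex_interior {d n : ℕ} (hn : 0 < n) (S : Affine.Simplex ℝ (E d) n) :
    ∃ x, x ∈ S.interior := by
  have hn' : (0 : ℝ) < n := by exact_mod_cast hn
  have hsum : ∑ _i : Fin (n + 1), ((n : ℝ) + 1)⁻¹ = 1 := by
    simp [Finset.sum_const]; field_simp
  refine ⟨_, fun _ => ((n : ℝ) + 1)⁻¹, hsum, fun i => ⟨by positivity, ?_⟩, rfl⟩
  exact inv_lt_one_of_one_lt₀ (by linarith)

/-- Shrinking by `1/2` about an interior point moves the closed simplex into the open one and scales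
the measure by `2⁻ᵏ`. This crude factor replaces a proof that the relative boundary is a null set.
-/
lemma euclideanHausdorffMeasure_closedInterior_le {d n : ℕ} (hn : 0 < n)
    (S : Affine.Simplex ℝ (E d) n) (k : ℕ) :
    (μHE[k] : Measure (E d)) S.closedInterior ≤ 2 ^ k * (μHE[k] : Measure (E d)) S.interior := by
  obtain ⟨c, hc⟩ := exists_mem_simplex_interior hn S
  have hsub : AffineMap.homothety c (1 / 2 : ℝ) '' S.closedInterior ⊆ S.interior := by
    rintro _ ⟨y, hy, rfl⟩
    have := lineMap_mem_simplex_interior S hc hy (t := 1 / 2) (by norm_num) (by norm_num)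
    rw [AffineMap.homothety_eq_lineMap]
    rw [AffineMap.lineMap_apply_module] at this ⊢
    convert this using 1
    rw [add_comm]; norm_num
  have h := measure_mono (μ := (μHE[k] : Measure (E d))) hsub
  rw [euclideanHausdorffMeasure_homothety_image _ _ (by norm_num), ENNReal.smul_def, smul_eq_mul] at h
  have h2 : (2 : ENNReal) ^ k * ((‖(1 / 2 : ℝ)‖₊ ^ k : NNReal) : ENNReal) = 1 := by
    have : ‖(1 / 2 : ℝ)‖₊ = 2⁻¹ := by ext; simp
    rw [this, ENNReal.coe_pow, ← mul_pow]
    simp [ENNReal.mul_inv_cancel]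
  calc _ = 2 ^ k * ((‖(1 / 2 : ℝ)‖₊ ^ k : NNReal) : ENNReal) * (μHE[k] : Measure (E d)) S.closedInterior := by
        rw [h2, one_mul]
    _ ≤ _ := by rw [mul_assoc]; gcongr

/-! ### Affine functions -/

/-- The mean square of an affine function over a set that is star-shaped with respect to midpoints
controls its value at the centre. -/
lemma sq_mul_volume_le {d : ℕ} {S : Set (E d)} (hSb : Bornology.IsBounded S)
    (v : E d) (hv : ∀ x ∈ S, AffineMap.homothety v (1 / 2 : ℝ) x ∈ S)
    (c : ℝ) (a : E d) :
    (c + inner ℝ a v) ^ 2 * volume.real S ≤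
      16 * (2 ^ d + 1) * ∫ x in S, (c + inner ℝ a x) ^ 2 := by
  set m := c + inner ℝ a v with hm
  set g : E d → ℝ := fun x => (c + inner ℝ a x) ^ 2 with hg
  have hgc : Continuous g := by fun_prop
  have hfin : volume S ≠ ⊤ := hSb.measure_lt_top.ne
  have hint : IntegrableOn g S :=
    (hgc.continuousOn.integrableOn_compact hSb.isCompact_closure).mono_set subset_closure
  -- The part where the affine function is at least `|m| / 4` in absolute value; Chebyshev's
  -- inequality bounds its volume.
  set U := {x : E d | m ^ 2 / 16 ≤ g x} with hU
  have hUm : MeasurableSet U := measurableSet_le measurable_const hgc.measurable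
  have hmark : m ^ 2 / 16 * volume.real (U ∩ S) ≤ ∫ x in S, g x := by
    have := mul_meas_ge_le_integral_of_nonneg (μ := volume.restrict S)
      (Eventually.of_forall fun x => sq_nonneg _ : 0 ≤ᵐ[volume.restrict S] g) hint (m ^ 2 / 16)
    rwa [measureReal_restrict_apply hUm] at this
  -- If the value at `x` is below `|m| / 4`, the value at the midpoint of `x` and `v` is at least
  -- `3|m| / 8` in absolute value. So `S \ U` contracts into `U ∩ S`, at the cost of a volume factor
  -- `2ᵈ`.
  have himg : AffineMap.homothety v (1 / 2 : ℝ) '' (S \ U) ⊆ U ∩ S := by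
    rintro _ ⟨x, ⟨hxS, hxU⟩, rfl⟩
    refine ⟨?_, hv x hxS⟩
    simp only [hU, hg, mem_ofPred_eq, not_le] at hxU ⊢
    have : c + inner ℝ a (AffineMap.homothety v (1 / 2 : ℝ) x) = (m + (c + inner ℝ a x)) / 2 := by
      rw [AffineMap.homothety_eq_lineMap, AffineMap.lineMap_apply_module, inner_add_right,
        inner_smul_right, inner_smul_right, hm]
      ring
    rw [this]
    nlinarith [sq_nonneg (m + 4 * (c + inner ℝ a x))]
  have h1 : volume.real (S \ U) ≤ 2 ^ d * volume.real (U ∩ S) := by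
    have h := measureReal_mono (μ := volume) himg (measure_ne_top_of_subset inter_subset_right hfin)
    rw [measureReal_def, Measure.addHaar_image_homothety, ENNReal.toReal_mul, ← measureReal_def,
      ENNReal.toReal_ofReal (abs_nonneg _), finrank_euclideanSpace_fin, abs_of_nonneg (by positivity),
      one_div, inv_pow] at h
    rwa [inv_mul_le_iff₀ (by positivity)] at h
  have h2 : volume.real S ≤ volume.real (U ∩ S) + volume.real (S \ U) := by
    rw [inter_comm]
    exact (measureReal_inter_add_sdiff₀ hUm.nullMeasurableSet hfin).ge
  have h3 : volume.real S ≤ (2 ^ d + 1) * volume.real (U ∩ S) := by linarith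
  have := mul_le_mul_of_nonneg_left h3 (sq_nonneg m)
  have h4 := mul_le_mul_of_nonneg_left hmark (by positivity : (0:ℝ) ≤ 16 * (2 ^ d + 1))
  linarith

/-- The points swept by a bounded part `A` of a hyperplane that is translated in the direction `-e`. -/
lemma volume_sweep_le {d : ℕ} {A : Set (E d)} (hA : IsCompact A) {n e : E d} (hn : ‖n‖ = 1)
    (hAn : ∀ x ∈ A, ∀ y ∈ A, inner ℝ (x - y) n = 0) (he : ‖e‖ ≤ 1) (m : ℝ) :
    volume ((fun z : E d × ℝ => z.1 - z.2 • e) '' (A ×ˢ Icc 0 m)) ≤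
      ENNReal.ofReal (2 * m) * (μHE[d - 1] : Measure (E d)) A := by
  set t := (fun z : E d × ℝ => z.1 - z.2 • e) '' (A ×ˢ Icc 0 m) with ht
  obtain rfl | ⟨p, hp⟩ := A.eq_empty_or_nonempty
  · simp [ht]
  have hn0 : n ≠ 0 := fun h => by simp [h] at hn
  have hplane : ∀ x ∈ t, ∃ z ∈ A, ∃ r ∈ Icc 0 m, x = z - r • e ∧
      inner ℝ n (x - p) = -(r * inner ℝ n e) := by
    rintro _ ⟨⟨z, r⟩, ⟨hz, hr⟩, rfl⟩
    refine ⟨z, hz, r, hr, rfl, ?_⟩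
    rw [sub_right_comm, inner_sub_right, inner_smul_right, real_inner_comm, hAn z hz p hp, zero_sub]
  by_cases hen : inner ℝ n e = 0
  -- Translation along the hyperplane never leaves it, so the swept set is null.
  · have hsub : t ⊆ AffineSubspace.mk' p (ℝ ∙ n)ᗮ := by
      intro x hx
      obtain ⟨z, -, r, -, -, h⟩ := hplane x hx
      rw [SetLike.mem_coe, AffineSubspace.mem_mk', vsub_eq_sub,
        Submodule.mem_orthogonal_singleton_iff_inner_right, h, hen, mul_zero, neg_zero]
    refine (measure_mono hsub).trans (le_of_eq_of_le (Measure.addHaar_affineSubspace _ _ ?_) zero_le)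
    intro h
    have h' := congrArg AffineSubspace.direction h
    rw [AffineSubspace.direction_mk', AffineSubspace.direction_top,
      Submodule.orthogonal_eq_top_iff, Submodule.span_singleton_eq_bot] at h'
    exact hn0 h'
  · have htm : MeasurableSet t :=
      ((hA.prod isCompact_Icc).image (by fun_prop)).isClosed.measurableSet
    -- Slice orthogonally to the normal line through `p`. The height of a slice determines the
    -- translation parameter, since `n · e ≠ 0`; each slice thus lies in one translate of `A`, and
    -- only heights in `[-m, m]` give nonempty slices.
    set s := AffineSubspace.mk' p (ℝ ∙ n) with hs
    have : Nonempty s := ⟨⟨p, AffineSubspace.self_mem_mk' _ _⟩⟩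
    have hdir : s.direction = ℝ ∙ n := AffineSubspace.direction_mk' _ _
    have hf1 : Module.finrank ℝ s.direction = 1 := by
      rw [hdir, finrank_span_singleton hn0]
    have hf2 : Module.finrank ℝ s.directionᗮ = d - 1 := by
      have := s.direction.finrank_add_finrank_orthogonal
      rw [hf1, finrank_euclideanSpace_fin] at this
      omega
    have hvol : volume t = (μHE[Module.finrank ℝ (E d)] : Measure (E d)) t := by
      rw [InnerProductSpace.euclideanHausdorffMeasure_eq_volume]
    rw [hvol, AffineSubspace.euclideanHausdorffMeasure_eq_lintegral s htm, hf1, hf2]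
    let φ : ℝ → s := fun r => ⟨r • n +ᵥ p, AffineSubspace.vadd_mem_mk' _
      (Submodule.smul_mem _ _ (Submodule.mem_span_singleton_self n))⟩
    have hφ : Isometry φ := by
      refine Isometry.of_dist_eq fun x y => ?_
      rw [Subtype.dist_eq]
      simp [φ, dist_eq_norm, ← sub_smul, norm_smul, hn]
    have hball : (μHE[1] : Measure s) (φ '' Icc (-m) m) = ENNReal.ofReal (2 * m) := by
      have h1 : (μHE[1] : Measure ℝ) = volume := by
        have := InnerProductSpace.euclideanHausdorffMeasure_eq_volume (V := ℝ)
        rwa [Module.finrank_self] at this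
      rw [hφ.euclideanHausdorffMeasure_image, h1, Real.volume_Icc]
      ring_nf
    have hmeas : MeasurableSet (φ '' Icc (-m) m) :=
      (isCompact_Icc.image hφ.continuous).isClosed.measurableSet
    rw [← hball, mul_comm, ← setLIntegral_const, ← lintegral_indicator hmeas]
    refine lintegral_mono fun x => ?_
    obtain hemp | ⟨y₀, hy₀, hy₀x⟩ := (t ∩ AffineSubspace.mk' x.val s.directionᗮ).eq_empty_or_nonempty
    · rw [hemp, measure_empty]; exact zero_le
    have hslice : ∀ y ∈ AffineSubspace.mk' x.val s.directionᗮ,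
        inner ℝ n (y - p) = inner ℝ n (x.val - p) := by
      intro y hy
      rw [AffineSubspace.mem_mk', vsub_eq_sub, hdir,
        Submodule.mem_orthogonal_singleton_iff_inner_right] at hy
      rw [← sub_add_sub_cancel y x.val p, inner_add_right, hy, zero_add]
    obtain ⟨z₀, hz₀, r₀, hr₀, rfl, h₀⟩ := hplane y₀ hy₀
    rw [hslice _ hy₀x] at h₀
    have hx : x ∈ φ '' Icc (-m) m := by
      obtain ⟨l, hl⟩ := Submodule.mem_span_singleton.1
        ((AffineSubspace.mem_mk' (p := p) (q := x.val)).1 x.2)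
      rw [vsub_eq_sub] at hl
      refine ⟨l, ?_, Subtype.ext ?_⟩
      · rw [← hl, inner_smul_right, real_inner_self_eq_norm_sq, hn, one_pow, mul_one] at h₀
        rw [mem_Icc, ← abs_le, h₀, abs_neg, abs_mul, abs_of_nonneg hr₀.1]
        have : |inner ℝ n e| ≤ 1 :=
          (abs_real_inner_le_norm n e).trans (by rw [hn, one_mul]; exact he)
        exact (mul_le_of_le_one_right hr₀.1 this).trans hr₀.2
      · simp only [φ, hl, vadd_eq_add, sub_add_cancel]
    rw [indicator_of_mem hx]
    have hsub : t ∩ AffineSubspace.mk' x.val s.directionᗮ ⊆ (fun z => -(r₀ • e) +ᵥ z) '' A := by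
      rintro y ⟨hy, hyx⟩
      obtain ⟨z, hz, r, hr, rfl, h⟩ := hplane y hy
      rw [hslice _ hyx, h₀, neg_inj] at h
      obtain rfl := mul_right_cancel₀ hen h
      exact ⟨z, hz, by simp [sub_eq_neg_add]⟩
    refine (measure_mono hsub).trans_eq ?_
    exact measure_vadd _ _ _

/-! ### Disjoint convex sets, maxima at vertices, and rays. -/

/-- The boundary of a convex set is null, so each `T f` may be replaced by its topological interior,
which is measurable. -/
lemma sum_setIntegral_le_of_convex_of_disjoint {d : ℕ} {ι : Type*} (s : Finset ι)
    {T : ι → Set (E d)} {U : Set (E d)} (hconv : ∀ f ∈ s, Convex ℝ (T f))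
    (hsub : ∀ f ∈ s, T f ⊆ U) (hdisj : ∀ f ∈ s, ∀ g ∈ s, f ≠ g → Disjoint (T f) (T g))
    {g : E d → ℝ} (hg : IntegrableOn g U) (hg0 : ∀ x, 0 ≤ g x) :
    ∑ f ∈ s, ∫ x in T f, g x ≤ ∫ x in U, g x := by
  have h1 : ∀ f ∈ s, ∫ x in T f, g x = ∫ x in interior (T f), g x := fun f hf =>
    (setIntegral_congr_set
      (interior_ae_eq_of_null_frontier ((hconv f hf).addHaar_frontier volume))).symm
  rw [Finset.sum_congr rfl h1, ← integral_biUnion_finset]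
  · exact setIntegral_mono_set hg (Eventually.of_forall hg0) (LE.le.eventuallyLE
      (iUnion₂_subset fun f hf => interior_subset.trans (hsub f hf)))
  · exact fun f _ => isOpen_interior.measurableSet
  · exact fun f hf g hg hfg => (hdisj f hf g hg hfg).mono interior_subset interior_subset
  · exact fun f hf => hg.mono_set (interior_subset.trans (hsub f hf))

/-- The absolute value of an affine function is convex, and the closed simplex is the convex hull of
its vertices. -/
lemma exists_vertex_abs_le {d n : ℕ} (S : Affine.Simplex ℝ (E d) n) (c : ℝ) (a : E d) :
    ∃ j, ∀ x ∈ S.closedInterior, |c + inner ℝ a x| ≤ |c + inner ℝ a (S.points j)| := by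
  obtain ⟨j, -, hj⟩ := Finset.exists_max_image Finset.univ
    (fun j => |c + inner ℝ a (S.points j)|) Finset.univ_nonempty
  refine ⟨j, ?_⟩
  set m := |c + inner ℝ a (S.points j)|
  have hconv : Convex ℝ {x : E d | |c + inner ℝ a x| ≤ m} := by
    intro x hx y hy s t hs ht hst
    simp only [mem_ofPred_eq, abs_le] at hx hy ⊢
    rw [inner_add_right, inner_smul_right, inner_smul_right]
    obtain rfl : t = 1 - s := by linarith
    constructor <;> nlinarith
  rw [← S.convexHull_eq_closedInterior]
  exact convexHull_min (range_subset_iff.2 fun k => hj k (Finset.mem_univ k)) hconv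

/-- A ray from a point of a bounded open set meets the frontier. -/
lemma exists_add_smul_mem_frontier {d : ℕ} {U : Set (E d)} (hU : IsOpen U)
    (hb : Bornology.IsBounded U) {x e : E d} (hx : x ∈ U) (he : e ≠ 0) :
    ∃ t : ℝ, 0 ≤ t ∧ x + t • e ∈ frontier U := by
  by_contra! H
  set φ : ℝ → E d := fun t => x + t • e with hφ
  have hpre : IsPreconnected (φ '' Ici 0) :=
    (convex_Ici (0 : ℝ)).isPreconnected.image _ (by fun_prop)
  have hsub : φ '' Ici 0 ⊆ U := by
    refine hpre.subset_of_closure_inter_subset hU ⟨x, ⟨0, by simp, by simp [hφ]⟩, hx⟩ ?_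
    rintro _ ⟨hy, t, ht, rfl⟩
    by_contra hyU
    exact H t ht ⟨hy, by rwa [hU.interior_eq]⟩
  obtain ⟨R, hR⟩ := (hb.subset hsub).exists_norm_le
  have he' : 0 < ‖e‖ := norm_pos_iff.2 he
  have hR0 : 0 ≤ R := (norm_nonneg _).trans (hR _ ⟨0, by simp, rfl⟩)
  have := hR _ ⟨(R + ‖x‖ + 1) / ‖e‖, by simp only [mem_Ici]; positivity, rfl⟩
  have h2 : ‖((R + ‖x‖ + 1) / ‖e‖) • e‖ = R + ‖x‖ + 1 := by
    rw [norm_smul, Real.norm_of_nonneg (by positivity)]; field_simp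
  have h3 := norm_sub_le (x + ((R + ‖x‖ + 1) / ‖e‖) • e) x
  rw [add_sub_cancel_left, h2] at h3
  simp only [hφ] at this
  linarith

/-! ### Elements, faces, and the sweeping bound for the volume of an element. -/

namespace PolytopicMesh

variable {d : ℕ} (M : PolytopicMesh d)

lemma isBounded_elem (i : Fin M.numElems) : Bornology.IsBounded (M.elem i) :=
  M.isBounded_domain.subset (M.elem_subset i)

lemma h_pos (hd : 0 < d) (i : Fin M.numElems) : 0 < M.h i := by
  have : NeZero d := ⟨hd.ne'⟩
  obtain ⟨x, hx⟩ := M.nonempty_elem i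
  exact Metric.diam_pos (infinite_of_mem_nhds x ((M.isOpen_elem i).mem_nhds hx)).nontrivial
    (M.isBounded_elem i)

lemma mem_facesOf {i : Fin M.numElems} {f : Fin M.numFaces} :
    f ∈ M.facesOf i ↔ M.IsFaceOf f i := by
  simp [facesOf]

lemma mem_adj {i : Fin M.numElems} {f : Fin M.numFaces} : i ∈ M.adj f ↔ M.IsFaceOf f i := by
  simp [adj]

lemma volume_real_elem_pos (i : Fin M.numElems) : 0 < volume.real (M.elem i) :=
  ENNReal.toReal_pos ((M.isOpen_elem i).measure_pos _ (M.nonempty_elem i)).ne'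
    (M.isBounded_elem i).measure_lt_top.ne

/-- Every point of an element lies between two points of its faces in any given direction; hence
the volume of the element is controlled by the values of an affine function on the faces. -/
lemma norm_mul_volume_elem_le (hd : 2 ≤ d) (i : Fin M.numElems)
    (hfin : ∀ f ∈ M.facesOf i, (μHE[d - 1] : Measure (E d)) (M.face f).interior ≠ ⊤)
    {c : ℝ} {a : E d} {m : Fin M.numFaces → ℝ}
    (hm : ∀ f ∈ M.facesOf i, ∀ x ∈ (M.face f).closedInterior, |c + inner ℝ a x| ≤ m f) :
    ‖a‖ * volume.real (M.elem i) ≤ 2 ^ (d + 1) * ∑ f ∈ M.facesOf i, M.faceArea f * m f := by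
  have hm0 : ∀ f ∈ M.facesOf i, 0 ≤ m f := fun f hf =>
    (abs_nonneg _).trans (hm f hf _ ((M.face f).point_mem_closedInterior 0))
  obtain rfl | ha := eq_or_ne a 0
  · rw [norm_zero, zero_mul]
    exact mul_nonneg (by positivity)
      (Finset.sum_nonneg fun f hf => mul_nonneg measureReal_nonneg (hm0 f hf))
  have ha' : 0 < ‖a‖ := norm_pos_iff.2 ha
  set e : E d := ‖a‖⁻¹ • a with he
  have hne : ‖e‖ = 1 := by rw [he, norm_smul, norm_inv, norm_norm]; field_simp
  have hae : inner ℝ a e = ‖a‖ := by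
    rw [he, inner_smul_right, real_inner_self_eq_norm_sq]; field_simp
  let sweep (f : Fin M.numFaces) (e : E d) : Set (E d) :=
    (fun z : E d × ℝ => z.1 - z.2 • e) '' ((M.face f).closedInterior ×ˢ Icc 0 (m f / ‖a‖))
  have hcover : M.elem i ⊆ ⋃ f ∈ M.facesOf i, (sweep f e ∪ sweep f (-e)) := by
    intro x hx
    -- Here `s` is a sign of the affine function at `x`. Along `s • e` its absolute value grows at
    -- rate `‖a‖`, so a face `f` hit after distance `t` satisfies `t * ‖a‖ ≤ m f`.
    have key : ∀ s : ℝ, (s = 1 ∨ s = -1) → 0 ≤ s * (c + inner ℝ a x) →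
        ∃ f ∈ M.facesOf i, x ∈ sweep f (s • e) := by
      intro s hs hsx
      have hse : s • e ≠ 0 := by
        rintro h
        have := congrArg norm h
        rcases hs with rfl | rfl <;> simp [hne] at this
      obtain ⟨t, ht, htx⟩ :=
        exists_add_smul_mem_frontier (M.isOpen_elem i) (M.isBounded_elem i) hx hse
      have htx' := htx
      rw [M.frontier_elem i] at htx'
      obtain ⟨f, hf, hxf⟩ := mem_iUnion₂.1 htx'
      have hf' : f ∈ M.facesOf i := M.mem_facesOf.2 hf
      refine ⟨f, hf', ⟨(x + t • s • e, t), ⟨hxf, ht, ?_⟩, by simp⟩⟩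
      have h1 := hm f hf' _ hxf
      rw [inner_add_right, inner_smul_right, inner_smul_right, hae] at h1
      rw [le_div_iff₀ ha']
      rcases hs with rfl | rfl
      · have := (le_abs_self _).trans h1; linarith
      · have := (neg_le_abs _).trans h1; linarith
    rcases le_total 0 (c + inner ℝ a x) with h0 | h0
    · obtain ⟨f, hf, hxf⟩ := key 1 (Or.inl rfl) (by linarith)
      exact mem_iUnion₂.2 ⟨f, hf, Or.inl (by simpa using hxf)⟩
    · obtain ⟨f, hf, hxf⟩ := key (-1) (Or.inr rfl) (by linarith)
      exact mem_iUnion₂.2 ⟨f, hf, Or.inr (by simpa using hxf)⟩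
  -- The factor `2 ^ d` is the `2` of `volume_sweep_le` times the `2 ^ (d - 1)` paid for passing
  -- from the closed face to the open one.
  have hsweep : ∀ f ∈ M.facesOf i, ∀ e' : E d, ‖e'‖ = 1 → volume (sweep f e') ≤
      ENNReal.ofReal (2 ^ d * (m f / ‖a‖) * M.faceArea f) := by
    intro f hf e' he'
    obtain ⟨n, hn1, hn2, -⟩ := M.exists_outwardNormal i f (M.mem_facesOf.1 hf)
    have hn3 : ∀ x ∈ (M.face f).closedInterior, inner ℝ (x - (M.face f).points 0) n = 0 := by
      have hconv : Convex ℝ {x : E d | inner ℝ (x - (M.face f).points 0) n = 0} := by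
        intro x hx y hy s t hs ht hst
        simp only [mem_ofPred_eq, inner_sub_left, inner_add_left, inner_smul_left,
          RCLike.conj_to_real] at hx hy ⊢
        obtain rfl : t = 1 - s := by linarith
        linear_combination s * hx + (1 - s) * hy
      rw [← (M.face f).convexHull_eq_closedInterior]
      exact convexHull_min (range_subset_iff.2 fun k => hn2 k 0) hconv
    refine (volume_sweep_le (M.face f).isCompact_closedInterior hn1 (fun x hx y hy => ?_) he'.le
      (m f / ‖a‖)).trans ?_
    · rw [← sub_sub_sub_cancel_right x y ((M.face f).points 0), inner_sub_left, hn3 x hx,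
        hn3 y hy, sub_zero]
    have hpow : (2 : ℝ) ^ d = 2 * 2 ^ (d - 1) := by
      rw [← pow_succ', Nat.sub_add_cancel (by omega)]
    calc _ ≤ ENNReal.ofReal (2 * (m f / ‖a‖)) *
          (2 ^ (d - 1) * (μHE[d - 1] : Measure (E d)) (M.face f).interior) := by
          gcongr
          exact euclideanHausdorffMeasure_closedInterior_le (by omega) _ _
      _ = _ := by
          have h2 : (2 : ENNReal) ^ (d - 1) = ENNReal.ofReal (2 ^ (d - 1)) := by
            rw [ENNReal.ofReal_pow (by norm_num)]; norm_num
          have hdiv := div_nonneg (hm0 f hf) ha'.le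
          rw [faceArea, ← ofReal_measureReal (hfin f hf), h2, ← ENNReal.ofReal_mul (by positivity),
            ← ENNReal.ofReal_mul (by positivity), hpow]
          congr 1; ring
  have hnn : ∀ f ∈ M.facesOf i, 0 ≤ 2 ^ d * (m f / ‖a‖) * M.faceArea f := fun f hf =>
    mul_nonneg (mul_nonneg (by positivity) (div_nonneg (hm0 f hf) ha'.le)) measureReal_nonneg
  have hvol : volume (M.elem i) ≤
      ENNReal.ofReal (∑ f ∈ M.facesOf i, 2 * (2 ^ d * (m f / ‖a‖) * M.faceArea f)) := by
    rw [ENNReal.ofReal_sum_of_nonneg fun f hf => mul_nonneg two_pos.le (hnn f hf)]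
    refine (measure_mono hcover).trans ((measure_biUnion_finset_le _ _).trans ?_)
    refine Finset.sum_le_sum fun f hf => (measure_union_le _ _).trans ?_
    rw [two_mul, ENNReal.ofReal_add (hnn f hf) (hnn f hf)]
    exact add_le_add (hsweep f hf e hne) (hsweep f hf (-e) (by rw [norm_neg, hne]))
  have hreal : volume.real (M.elem i) ≤
      ∑ f ∈ M.facesOf i, 2 * (2 ^ d * (m f / ‖a‖) * M.faceArea f) :=
    ENNReal.toReal_le_of_le_ofReal
      (Finset.sum_nonneg fun f hf => mul_nonneg two_pos.le (hnn f hf)) hvol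
  calc _ ≤ ‖a‖ * ∑ f ∈ M.facesOf i, 2 * (2 ^ d * (m f / ‖a‖) * M.faceArea f) := by gcongr
    _ = _ := by
      rw [Finset.mul_sum, Finset.mul_sum]
      refine Finset.sum_congr rfl fun f _ => ?_
      field_simp
      ring

variable {M}

/-! ### Inverse estimates for affine functions, uniform in the number of faces. -/

namespace ArbitraryFaces

variable {Cs : ℝ}

/-- Division by zero yields `0`, so a vanishing `faceArea` would turn the mesh assumption into `h ≤
0`. -/
lemma faceArea_pos (hA : M.ArbitraryFaces Cs) (hd : 0 < d) {i : Fin M.numElems}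
    {f : Fin M.numFaces} (hf : f ∈ M.facesOf i) : 0 < M.faceArea f := by
  obtain ⟨T, hT, -⟩ := hA i
  refine measureReal_nonneg.lt_of_ne' fun h0 => ?_
  have h := (hT f hf).2.2
  rw [faceArea, h0, div_zero, mul_zero] at h
  exact (M.h_pos hd i).not_ge h

/-- An infinite measure has real value `0`, which positivity of the area excludes. -/
lemma faceMeasure_ne_top (hA : M.ArbitraryFaces Cs) (hd : 0 < d) {i : Fin M.numElems}
    {f : Fin M.numFaces} (hf : f ∈ M.facesOf i) :
    (μHE[d - 1] : Measure (E d)) (M.face f).interior ≠ ⊤ := fun h => by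
  have := hA.faceArea_pos hd hf
  simp [faceArea, measureReal_def, h] at this

lemma h_mul_sum_faceArea_mul_sq_le (hA : M.ArbitraryFaces Cs) (hCs : 0 < Cs) (hd : 0 < d)
    (i : Fin M.numElems) (c : ℝ) (a : E d) :
    ∃ m : Fin M.numFaces → ℝ,
      (∀ f ∈ M.facesOf i, ∀ x ∈ (M.face f).closedInterior, |c + inner ℝ a x| ≤ m f) ∧
      M.h i * ∑ f ∈ M.facesOf i, M.faceArea f * m f ^ 2 ≤
        16 * (2 ^ d + 1) * (Cs * d) * ∫ x in M.elem i, (c + inner ℝ a x) ^ 2 := by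
  choose j hj using fun f => exists_vertex_abs_le (M.face f) c a
  refine ⟨fun f => |c + inner ℝ a ((M.face f).points (j f))|, fun f _ => hj f, ?_⟩
  have hA' := hA
  obtain ⟨T, hT, hdisj⟩ := hA' i
  have hcont : Continuous fun x : E d => (c + inner ℝ a x) ^ 2 := by fun_prop
  have hint : IntegrableOn (fun x : E d => (c + inner ℝ a x) ^ 2) (M.elem i) :=
    (hcont.continuousOn.integrableOn_compact (M.isBounded_elem i).isCompact_closure).mono_set
      subset_closure
  have hsum := sum_setIntegral_le_of_convex_of_disjoint (M.facesOf i)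
    (fun f _ => convex_simplex_interior (T f)) (fun f hf => (hT f hf).1) hdisj hint
    (fun x => sq_nonneg _)
  have hface : ∀ f ∈ M.facesOf i, M.h i * (M.faceArea f *
      |c + inner ℝ a ((M.face f).points (j f))| ^ 2) ≤
      16 * (2 ^ d + 1) * (Cs * d) * ∫ x in (T f).interior, (c + inner ℝ a x) ^ 2 := by
    intro f hf
    obtain ⟨hTs, hTv, hTh⟩ := hT f hf
    have hpos := hA.faceArea_pos hd hf
    -- The maximising vertex of the face is also a vertex of `T f`, so `T f` is mapped into itself
    -- by the midpoint contraction towards it.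
    obtain ⟨k, hk⟩ := hTv ⟨j f, rfl⟩
    have hstar : ∀ x ∈ (T f).interior,
        AffineMap.homothety ((M.face f).points (j f)) (1 / 2 : ℝ) x ∈ (T f).interior := by
      intro x hx
      rw [AffineMap.homothety_eq_lineMap, ← hk]
      exact lineMap_mem_simplex_interior _ hx ((T f).point_mem_closedInterior k)
        (by norm_num) (by norm_num)
    have h1 := sq_mul_volume_le ((M.isBounded_elem i).subset hTs) _ hstar c a
    have h2 : M.h i * M.faceArea f ≤ Cs * d * volume.real (T f).interior := by
      rw [mul_div_assoc', le_div_iff₀ hpos] at hTh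
      linarith
    rw [sq_abs]
    have h3 := mul_le_mul_of_nonneg_right h2
      (sq_nonneg (c + inner ℝ a ((M.face f).points (j f))))
    have h4 := mul_le_mul_of_nonneg_left h1 (by positivity : 0 ≤ Cs * (d : ℝ))
    linarith
  rw [Finset.mul_sum]
  refine (Finset.sum_le_sum hface).trans ?_
  rw [← Finset.mul_sum]
  gcongr

/-- The volumes of the non-overlapping simplices `T f` add up to at most that of the element. -/
lemma h_mul_sum_faceArea_le (hA : M.ArbitraryFaces Cs) (hCs : 0 < Cs) (hd : 0 < d)
    (i : Fin M.numElems) :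
    M.h i * ∑ f ∈ M.facesOf i, M.faceArea f ≤ Cs * d * volume.real (M.elem i) := by
  have hA' := hA
  obtain ⟨T, hT, hdisj⟩ := hA' i
  have hsum := sum_setIntegral_le_of_convex_of_disjoint (g := fun _ => 1) (M.facesOf i)
    (fun f _ => convex_simplex_interior (T f)) (fun f hf => (hT f hf).1) hdisj
    (integrableOn_const (M.isBounded_elem i).measure_lt_top.ne) (fun x => zero_le_one)
  simp only [setIntegral_const, smul_eq_mul, mul_one] at hsum
  rw [Finset.mul_sum]
  refine le_trans (Finset.sum_le_sum (g := fun f => Cs * d * volume.real (T f).interior)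
    fun f hf => ?_) ?_
  · have hTh := (hT f hf).2.2
    rw [mul_div_assoc', le_div_iff₀ (hA.faceArea_pos hd hf)] at hTh
    linarith
  · rw [← Finset.mul_sum]
    gcongr

/-- The inverse estimate for the (constant) gradient of an affine function, on the faces. -/
lemma h_pow_mul_norm_sq_mul_sum_faceArea_le (hA : M.ArbitraryFaces Cs) (hCs : 0 < Cs)
    (hd : 2 ≤ d) (i : Fin M.numElems) (c : ℝ) (a : E d) :
    M.h i ^ 3 * ∑ f ∈ M.facesOf i, M.faceArea f * ‖a‖ ^ 2 ≤
      (2 ^ (d + 1)) ^ 2 * (16 * (2 ^ d + 1)) * (Cs * d) ^ 3 *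
        ∫ x in M.elem i, (c + inner ℝ a x) ^ 2 := by
  have hd0 : 0 < d := by omega
  have hh := M.h_pos hd0 i
  have hV := M.volume_real_elem_pos i
  obtain ⟨m, hm, hsum⟩ := hA.h_mul_sum_faceArea_mul_sq_le hCs hd0 i c a
  have h1 := M.norm_mul_volume_elem_le hd i (fun f hf => hA.faceMeasure_ne_top hd0 hf) hm
  have h2 := hA.h_mul_sum_faceArea_le hCs hd0 i
  have hf0 : ∀ f, 0 ≤ M.faceArea f := fun f => measureReal_nonneg
  -- Cauchy–Schwarz weighted by area: `(∑ |F| m_F)² ≤ (∑ |F|) (∑ |F| m_F²)`.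
  have hCS := Finset.sum_mul_sq_le_sq_mul_sq (M.facesOf i) (fun f => √(M.faceArea f))
    (fun f => √(M.faceArea f) * m f)
  simp only [← mul_assoc, mul_pow, Real.mul_self_sqrt (hf0 _), Real.sq_sqrt (hf0 _)] at hCS
  set V := volume.real (M.elem i)
  set I := ∫ x in M.elem i, (c + inner ℝ a x) ^ 2 with hI
  set A := ∑ f ∈ M.facesOf i, M.faceArea f with hA
  set A1 := ∑ f ∈ M.facesOf i, M.faceArea f * m f
  set A2 := ∑ f ∈ M.facesOf i, M.faceArea f * m f ^ 2
  have hI0 : 0 ≤ I := integral_nonneg fun x => sq_nonneg _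
  have hA0 : 0 ≤ A := Finset.sum_nonneg fun f _ => measureReal_nonneg
  have hA2 : 0 ≤ A2 := Finset.sum_nonneg fun f _ => mul_nonneg measureReal_nonneg (sq_nonneg _)
  have h3 : (‖a‖ * V) ^ 2 ≤ (2 ^ (d + 1)) ^ 2 * (A * A2) := by
    calc _ ≤ (2 ^ (d + 1) * A1) ^ 2 := by gcongr
      _ ≤ _ := by rw [mul_pow]; gcongr
  have h4 : M.h i ^ 2 * (A * A2) ≤ (Cs * d * V) * (16 * (2 ^ d + 1) * (Cs * d) * I) := by
    calc _ = (M.h i * A) * (M.h i * A2) := by ring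
      _ ≤ _ := by gcongr
  -- One factor `V` cancels: the sweeping bound carries `V²` on the left, and `h A ≤ C V` brings one
  -- `V` on the right.
  have h5 : M.h i ^ 2 * ‖a‖ ^ 2 * V ≤
      (2 ^ (d + 1)) ^ 2 * (16 * (2 ^ d + 1)) * (Cs * d) ^ 2 * I := by
    refine le_of_mul_le_mul_right ?_ hV
    calc _ = M.h i ^ 2 * (‖a‖ * V) ^ 2 := by ring
      _ ≤ M.h i ^ 2 * ((2 ^ (d + 1)) ^ 2 * (A * A2)) := by gcongr
      _ = (2 ^ (d + 1)) ^ 2 * (M.h i ^ 2 * (A * A2)) := by ring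
      _ ≤ (2 ^ (d + 1)) ^ 2 * ((Cs * d * V) * (16 * (2 ^ d + 1) * (Cs * d) * I)) := by gcongr
      _ = _ := by ring
  rw [← Finset.sum_mul]
  calc _ = (M.h i ^ 2 * ‖a‖ ^ 2) * (M.h i * A) := by ring
    _ ≤ (M.h i ^ 2 * ‖a‖ ^ 2) * (Cs * d * V) := by gcongr
    _ = (Cs * d) * (M.h i ^ 2 * ‖a‖ ^ 2 * V) := by ring
    _ ≤ (Cs * d) * ((2 ^ (d + 1)) ^ 2 * (16 * (2 ^ d + 1)) * (Cs * d) ^ 2 * I) := by gcongr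
    _ = _ := by ring

end ArbitraryFaces

end PolytopicMesh

/-! ### Products of square integrable functions -/

lemma abs_inner_le_of_pos {V : Type*} [NormedAddCommGroup V] [InnerProductSpace ℝ V] (a b : V)
    {s : ℝ} (hs : 0 < s) : |inner ℝ a b| ≤ (s * ‖a‖ ^ 2 + s⁻¹ * ‖b‖ ^ 2) / 2 := by
  refine (abs_real_inner_le_norm a b).trans ?_
  have h : 0 ≤ s⁻¹ * (s * ‖a‖ - ‖b‖) ^ 2 := by positivity
  have h2 : s⁻¹ * (s * ‖a‖ - ‖b‖) ^ 2 = s * ‖a‖ ^ 2 + s⁻¹ * ‖b‖ ^ 2 - 2 * (‖a‖ * ‖b‖) := by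
    field_simp
    ring
  linarith

lemma integrable_inner_of_memLp {X V : Type*} [MeasurableSpace X] {μ : Measure X}
    [NormedAddCommGroup V] [InnerProductSpace ℝ V] {a b : X → V} (ha : MemLp a 2 μ)
    (hb : MemLp b 2 μ) : Integrable (fun x => inner ℝ (a x) (b x)) μ := by
  have ha2 := ha.integrable_norm_pow (p := 2) two_ne_zero
  have hb2 := hb.integrable_norm_pow (p := 2) two_ne_zero
  refine (ha2.add hb2).mono' (ha.1.inner hb.1) (Eventually.of_forall fun x => ?_)
  have := abs_inner_le_of_pos (a x) (b x) one_pos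
  simp only [Real.norm_eq_abs, Pi.add_apply]
  have := sq_nonneg ‖a x‖
  have := sq_nonneg ‖b x‖
  linarith

/-- Stated with a free parameter `s`, so that the penalty weight of each face can be put into it. -/
lemma abs_integral_inner_le {X V : Type*} [MeasurableSpace X] {μ : Measure X}
    [NormedAddCommGroup V] [InnerProductSpace ℝ V] {a b : X → V} (ha : MemLp a 2 μ)
    (hb : MemLp b 2 μ) {s : ℝ} (hs : 0 < s) :
    |∫ x, inner ℝ (a x) (b x) ∂μ| ≤ (s * ∫ x, ‖a x‖ ^ 2 ∂μ + s⁻¹ * ∫ x, ‖b x‖ ^ 2 ∂μ) / 2 := by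
  have ha2 := ha.integrable_norm_pow (p := 2) two_ne_zero
  have hb2 := hb.integrable_norm_pow (p := 2) two_ne_zero
  calc _ ≤ ∫ x, |inner ℝ (a x) (b x)| ∂μ := abs_integral_le_integral_abs
    _ ≤ ∫ x, (s * ‖a x‖ ^ 2 + s⁻¹ * ‖b x‖ ^ 2) / 2 ∂μ :=
        integral_mono (integrable_inner_of_memLp ha hb).abs
          (((ha2.const_mul _).add (hb2.const_mul _)).div_const _)
          fun x => abs_inner_le_of_pos _ _ hs
    _ = _ := by
        rw [integral_div, integral_add (ha2.const_mul _) (hb2.const_mul _), integral_const_mul,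
          integral_const_mul]

lemma abs_integral_mul_le {X : Type*} [MeasurableSpace X] {μ : Measure X} {a b : X → ℝ}
    (ha : MemLp a 2 μ) (hb : MemLp b 2 μ) {s : ℝ} (hs : 0 < s) :
    |∫ x, a x * b x ∂μ| ≤ (s * ∫ x, a x ^ 2 ∂μ + s⁻¹ * ∫ x, b x ^ 2 ∂μ) / 2 := by
  have := abs_integral_inner_le ha hb hs
  simpa only [RCLike.inner_apply, RCLike.conj_to_real, Real.norm_eq_abs, sq_abs, mul_comm (b _)]
    using this

/-- For `b > 0` the quadratic `x² s² - b s + y²` is nonnegative for all real `s`, so its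
discriminant is not positive. This also covers `x = 0` and `y = 0`, where no optimal `s` exists. -/
lemma le_two_mul_mul_of_forall_pos {b x y : ℝ} (hx : 0 ≤ x) (hy : 0 ≤ y)
    (h : ∀ s > 0, b ≤ s * x ^ 2 + s⁻¹ * y ^ 2) : b ≤ 2 * (x * y) := by
  rcases le_or_gt b 0 with hb | hb
  · exact hb.trans (by positivity)
  have hd : discrim (x ^ 2) (-b) (y ^ 2) ≤ 0 := by
    refine discrim_le_zero fun s => ?_
    rcases le_or_gt s 0 with hs | hs
    · have : 0 ≤ -b * s := mul_nonneg_of_nonpos_of_nonpos (by linarith) hs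
      have := mul_nonneg (sq_nonneg x) (mul_self_nonneg s)
      have := sq_nonneg y
      linarith
    · have h1 := mul_le_mul_of_nonneg_left (h s hs) hs.le
      rw [mul_add, mul_inv_cancel_left₀ hs.ne'] at h1
      linarith
  rw [discrim] at hd
  exact (sq_le_sq₀ hb.le (by positivity)).1 (by linarith)

/-! ### Polynomials of degree at most one -/

lemma exists_eval_eq_const_add_inner {d : ℕ} {P : MvPolynomial (Fin d) ℝ}
    (hP : P.totalDegree ≤ 1) : ∃ (c : ℝ) (a : E d),
      (∀ x : E d, MvPolynomial.eval (fun j => x j) P = c + inner ℝ a x) ∧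
      ∀ x : E d, (WithLp.toLp 2 fun l => MvPolynomial.eval (fun j => x j)
        (MvPolynomial.pderiv l P) : E d) = a := by
  rw [← P.support_sum_monomial_coeff]
  refine Finset.sum_induction _ (fun P : MvPolynomial (Fin d) ℝ => ∃ (c : ℝ) (a : E d),
      (∀ x : E d, MvPolynomial.eval (fun j => x j) P = c + inner ℝ a x) ∧
      ∀ x : E d, (WithLp.toLp 2 fun l => MvPolynomial.eval (fun j => x j)
        (MvPolynomial.pderiv l P) : E d) = a) ?_ ?_ ?_
  · rintro P Q ⟨c, a, h1, h2⟩ ⟨c', a', h1', h2'⟩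
    refine ⟨c + c', a + a', fun x => ?_, fun x => ?_⟩
    · rw [map_add, h1, h1', inner_add_left]; ring
    · rw [← h2 x, ← h2' x]
      ext l
      simp
  · exact ⟨0, 0, by simp, fun x => by ext; simp⟩
  · intro m hm
    have hdeg : m.degree ≤ 1 := (MvPolynomial.le_totalDegree hm).trans hP
    generalize P.coeff m = r
    rcases Nat.le_one_iff_eq_zero_or_eq_one.1 hdeg with h0 | h1
    · rw [Finsupp.degree_eq_zero_iff] at h0
      subst h0
      exact ⟨r, 0, by simp, fun x => by
        ext; simp⟩
    · obtain ⟨j, rfl⟩ : ∃ j, m = Finsupp.single j 1 := by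
        have hm0 : m ≠ 0 := by rintro rfl; simp at h1
        obtain ⟨j, hj⟩ := Finsupp.ne_iff.1 hm0
        refine ⟨j, ?_⟩
        have hle : Finsupp.single j 1 ≤ m := by
          rw [Finsupp.single_le_iff]; exact Nat.one_le_iff_ne_zero.2 hj
        have h2 := congrArg Finsupp.degree (tsub_add_cancel_of_le hle)
        rw [map_add, Finsupp.degree_single, h1, Nat.add_eq_right, Finsupp.degree_eq_zero_iff] at h2
        rw [← tsub_add_cancel_of_le hle, h2, zero_add]
      refine ⟨0, EuclideanSpace.single j r, fun x => ?_, fun x => ?_⟩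
      · simp [MvPolynomial.eval_monomial, EuclideanSpace.inner_single_left]
      · ext l
        change MvPolynomial.eval (fun j => x j) (MvPolynomial.pderiv l _) = _
        rw [MvPolynomial.pderiv_monomial]
        by_cases hl : l = j
        · subst hl; simp
        · simp [hl]

/-! ### Square integrability -/

/-- Valid for every `u`, because the default value `0` is square integrable; `memLp_trace` works in
the same way. -/
lemma memLp_weakPartial {d : ℕ} (U : Set (E d)) (j : Fin d) (u : E d → ℝ) :
    MemLp (weakPartial U j u) 2 (volume.restrict U) := by
  unfold weakPartial
  split_ifs with h
  · exact h.choose_spec.1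
  · exact MemLp.zero'

lemma memLp_weakLaplacian {d : ℕ} (U : Set (E d)) (u : E d → ℝ) :
    MemLp (weakLaplacian U u) 2 (volume.restrict U) :=
  memLp_finsetSum _ fun j _ => memLp_weakPartial U j _

namespace PolytopicMesh

variable {d : ℕ} (M : PolytopicMesh d)

lemma memLp_trace {i : Fin M.numElems} {f : Fin M.numFaces} (hf : M.IsFaceOf f i)
    (v : E d → ℝ) : MemLp (M.trace i v) 2 (M.faceMeasure f) := by
  unfold trace
  split_ifs with h
  · exact h.choose_spec.1 f (M.mem_facesOf.2 hf)
  · exact MemLp.zero'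

lemma memLp_jump (f : Fin M.numFaces) (v : E d → ℝ) :
    MemLp (M.jump f v) 2 (M.faceMeasure f) := by
  refine memLp_finsetSum _ fun i hi => ?_
  have h := M.memLp_trace (M.mem_adj.1 hi) v
  exact ((ContinuousLinearMap.id ℝ ℝ).smulRight (M.normal i f)).comp_memLp' h

lemma memLp_gradJump (f : Fin M.numFaces) (v : E d → ℝ) :
    MemLp (M.gradJump f v) 2 (M.faceMeasure f) := by
  refine memLp_finsetSum _ fun i hi => MemLp.inner_const ?_ _
  have h : ∀ j, MemLp (M.trace i (weakPartial (M.elem i) j v)) 2 (M.faceMeasure f) :=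
    fun j => M.memLp_trace (M.mem_adj.1 hi) _
  -- The vector trace is the sum of its scalar components times the coordinate vectors.
  have := memLp_finsetSum Finset.univ fun j _ =>
    ((ContinuousLinearMap.id ℝ ℝ).smulRight (coordVec j : E d)).comp_memLp' (h j)
  convert this using 1
  ext x l
  simp [gradTrace, coordVec, Finset.sum_apply, Pi.single_apply]

variable {M} in
lemma ArbitraryFaces.isFiniteMeasure_faceMeasure {Cs : ℝ} (hA : M.ArbitraryFaces Cs) (hd : 0 < d)
    (f : Fin M.numFaces) : IsFiniteMeasure (M.faceMeasure f) := by
  obtain ⟨i, hi⟩ : ∃ i, M.IsFaceOf f i := by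
    rcases M.interior_or_boundary f with ⟨-, i, j, -, h⟩ | ⟨-, i, h⟩
    · exact ⟨i, (h i).2 (Or.inl rfl)⟩
    · exact ⟨i, (h i).2 rfl⟩
  refine ⟨?_⟩
  rw [faceMeasure, Measure.restrict_apply_univ]
  exact (hA.faceMeasure_ne_top hd (M.mem_facesOf.2 hi)).lt_top

lemma ae_faceMeasure_mem_closedInterior (f : Fin M.numFaces) :
    ∀ᵐ x ∂M.faceMeasure f, x ∈ (M.face f).closedInterior :=
  ae_restrict_of_ae_restrict_of_subset (M.face f).interior_subset_closedInterior
    (ae_restrict_mem (M.face f).isClosed_closedInterior.measurableSet)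

lemma memLp_faceMeasure_of_continuous {V : Type*} [NormedAddCommGroup V]
    [SecondCountableTopologyEither (E d) V] (f : Fin M.numFaces)
    [IsFiniteMeasure (M.faceMeasure f)] {g : E d → V} (hg : Continuous g) :
    MemLp g 2 (M.faceMeasure f) := by
  obtain ⟨C, hC⟩ := (M.face f).isCompact_closedInterior.exists_bound_of_continuousOn hg.continuousOn
  exact MemLp.of_bound hg.aestronglyMeasurable C
    ((M.ae_faceMeasure_mem_closedInterior f).mono hC)

lemma adj_nonempty (f : Fin M.numFaces) : (M.adj f).Nonempty := by
  rcases M.interior_or_boundary f with ⟨-, i, j, -, h⟩ | ⟨-, i, h⟩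
  · exact ⟨i, M.mem_adj.2 ((h i).2 (Or.inl rfl))⟩
  · exact ⟨i, M.mem_adj.2 ((h i).2 rfl)⟩

lemma mean_pos (f : Fin M.numFaces) {q : Fin M.numElems → ℝ} (hq : ∀ i, 0 < q i) :
    0 < M.mean f q :=
  mul_pos (inv_pos.2 (Nat.cast_pos.2 (M.adj_nonempty f).card_pos))
    (Finset.sum_pos (fun i _ => hq i) (M.adj_nonempty f))

lemma ratio_pos (hd : 0 < d) (p : Fin M.numElems → ℕ) (i : Fin M.numElems) :
    0 < M.ratio p i := by
  have := M.h_pos hd i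
  unfold ratio
  positivity

/-- The degree factor is at least `1`. Only the scaling in `h` is needed from `q`. -/
lemma inv_h_le_ratio (hd : 0 < d) (p : Fin M.numElems → ℕ) (i : Fin M.numElems) :
    (M.h i)⁻¹ ≤ M.ratio p i := by
  have := M.h_pos hd i
  rw [ratio, inv_eq_one_div]
  have hd' : (1 : ℝ) ≤ d := by exact_mod_cast hd
  have hp : (0 : ℝ) ≤ p i := Nat.cast_nonneg _
  gcongr
  nlinarith

/-! ### The `L₂`-projection of the Laplacian -/

lemma piecewise_of_mem {i : Fin M.numElems} {x : E d} (hx : x ∈ M.elem i)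
    (P : Fin M.numElems → MvPolynomial (Fin d) ℝ) :
    M.piecewise P x = MvPolynomial.eval (fun j => x j) (P i) := by
  rw [piecewise, Finset.sum_eq_single i]
  · rw [indicator_of_mem hx]
  · exact fun k _ hk => indicator_of_notMem
      (fun hxk => (M.disjoint_elem k i hk).notMem_of_mem_left hxk hx) _
  · simp

lemma brokenLaplacian_of_mem {i : Fin M.numElems} {x : E d} (hx : x ∈ M.elem i)
    (v : E d → ℝ) : M.brokenLaplacian v x = weakLaplacian (M.elem i) v x := by
  rw [brokenLaplacian, Finset.sum_eq_single i]
  · rw [indicator_of_mem hx]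
  · exact fun k _ hk => indicator_of_notMem
      (fun hxk => (M.disjoint_elem k i hk).notMem_of_mem_left hxk hx) _
  · simp

lemma degreeLE_projLaplacian (p : Fin M.numElems → ℕ) (v : E d → ℝ) :
    M.DegreeLE (fun i => p i - 2) (M.projLaplacian p v) := by
  unfold projLaplacian l2Proj
  split_ifs with h
  · exact h.choose_spec.1
  · exact fun i => Submodule.zero_mem _

lemma continuous_eval (P : MvPolynomial (Fin d) ℝ) :
    Continuous fun x : E d => MvPolynomial.eval (fun j => x j) P :=
  (MvPolynomial.continuous_eval P).comp (by fun_prop)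

lemma memLp_eval_elem (i : Fin M.numElems) (P : MvPolynomial (Fin d) ℝ) :
    MemLp (fun x : E d => MvPolynomial.eval (fun j => x j) P) 2
      (volume.restrict (M.elem i)) := by
  have hb := M.isBounded_elem i
  have : IsFiniteMeasure (volume.restrict (M.elem i)) := ⟨by
    rw [Measure.restrict_apply_univ]; exact hb.measure_lt_top⟩
  obtain ⟨C, hC⟩ := hb.isCompact_closure.exists_bound_of_continuousOn
    (continuous_eval P).continuousOn
  exact MemLp.of_bound (continuous_eval P).aestronglyMeasurable C
    ((ae_restrict_mem (M.isOpen_elem i).measurableSet).mono fun x hx => hC x (subset_closure hx))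

/-- The discontinuous space contains the extension by zero of `P i` from one element, so
orthogonality localises. -/
lemma IsL2Proj.setIntegral_elem_eq_zero {k : Fin M.numElems → ℕ} {w : E d → ℝ}
    {P : Fin M.numElems → MvPolynomial (Fin d) ℝ} (h : M.IsL2Proj k w P) (i : Fin M.numElems) :
    ∫ x in M.elem i, (w x - MvPolynomial.eval (fun j => x j) (P i)) *
      MvPolynomial.eval (fun j => x j) (P i) = 0 := by
  classical
  have h1 := h.2 (Pi.single i (P i)) fun k => by
    by_cases hk : k = i
    · subst hk; rw [Pi.single_eq_same]; exact h.1 k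
    · rw [Pi.single_eq_of_ne hk]; exact Submodule.zero_mem _
  rw [← h1, ← inter_eq_right.2 (M.elem_subset i),
    ← setIntegral_indicator (M.isOpen_elem i).measurableSet]
  refine integral_congr_ae (Eventually.of_forall fun x => ?_)
  by_cases hx : x ∈ M.elem i
  · simp only [indicator_of_mem hx, M.piecewise_of_mem hx, Pi.single_eq_same]
  · have h0 : M.piecewise (Pi.single i (P i)) x = 0 := by
      refine Finset.sum_eq_zero fun k _ => ?_
      by_cases hk : k = i
      · subst hk; exact indicator_of_notMem hx _
      · simp [Pi.single_eq_of_ne hk]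
    simp only [indicator_of_notMem hx, h0, mul_zero]

/-- Pythagoras on a single element: the projection and the remainder are orthogonal there. -/
lemma integral_sq_projLaplacian_le (p : Fin M.numElems → ℕ) (v : E d → ℝ) (i : Fin M.numElems) :
    ∫ x in M.elem i, MvPolynomial.eval (fun j => x j) (M.projLaplacian p v i) ^ 2 ≤
      ∫ x in M.elem i, weakLaplacian (M.elem i) v x ^ 2 := by
  by_cases h : ∃ P, M.IsL2Proj (fun i => p i - 2) (M.brokenLaplacian v) P
  swap
  -- In the default branch the projection is `0` and the bound is trivial.
  · rw [projLaplacian, l2Proj, dif_neg h]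
    simpa using integral_nonneg fun x => sq_nonneg _
  have hP : M.IsL2Proj (fun i => p i - 2) (M.brokenLaplacian v) (M.projLaplacian p v) := by
    rw [projLaplacian, l2Proj, dif_pos h]; exact h.choose_spec
  have h0 := IsL2Proj.setIntegral_elem_eq_zero M hP i
  set g : E d → ℝ := fun x => MvPolynomial.eval (fun j => x j) (M.projLaplacian p v i)
  set w := weakLaplacian (M.elem i) v
  have hw : MemLp w 2 (volume.restrict (M.elem i)) := memLp_weakLaplacian _ _
  have hg : MemLp g 2 (volume.restrict (M.elem i)) := M.memLp_eval_elem i _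
  have h1 : ∫ x in M.elem i, (w x - g x) * g x = 0 := by
    rw [← h0]
    refine setIntegral_congr_fun (M.isOpen_elem i).measurableSet fun x hx => ?_
    simp only [M.brokenLaplacian_of_mem hx, g, w]
  have hi1 : Integrable (fun x => (w x - g x) * g x) (volume.restrict (M.elem i)) :=
    (hw.sub hg).integrable_mul hg
  have hi2 : Integrable (fun x => (w x - g x) ^ 2) (volume.restrict (M.elem i)) :=
    (hw.sub hg).integrable_sq
  have hi3 : Integrable (fun x => (w x - g x) ^ 2 + 2 * ((w x - g x) * g x))
      (volume.restrict (M.elem i)) := hi2.add (hi1.const_mul 2)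
  have key : ∫ x in M.elem i, w x ^ 2 = (∫ x in M.elem i, (w x - g x) ^ 2) +
      (∫ x in M.elem i, 2 * ((w x - g x) * g x)) + ∫ x in M.elem i, g x ^ 2 := by
    rw [← integral_add hi2 (hi1.const_mul 2), ← integral_add hi3 hg.integrable_sq]
    exact integral_congr_ae (Eventually.of_forall fun x => by ring)
  rw [key, integral_const_mul, h1, mul_zero, add_zero]
  have : 0 ≤ ∫ x in M.elem i, (w x - g x) ^ 2 := integral_nonneg fun x => sq_nonneg _
  linarith

end PolytopicMesh

/-! ### Face averages and the bounds in the dual weights. -/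

namespace PolytopicMesh

variable {d : ℕ} (M : PolytopicMesh d)

lemma continuous_mean {V : Type} [NormedAddCommGroup V] [InnerProductSpace ℝ V]
    {g : Fin M.numElems → E d → V} (hg : ∀ i, Continuous (g i)) (f : Fin M.numFaces) :
    Continuous fun x => M.mean f fun i => g i x := by
  unfold mean
  fun_prop

lemma norm_sq_mean_le {V : Type} [NormedAddCommGroup V] [InnerProductSpace ℝ V]
    (f : Fin M.numFaces) (a : Fin M.numElems → V) :
    ‖M.mean f a‖ ^ 2 ≤ ((M.adj f).card : ℝ)⁻¹ * ∑ i ∈ M.adj f, ‖a i‖ ^ 2 := by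
  have hn : (0 : ℝ) < (M.adj f).card := Nat.cast_pos.2 (M.adj_nonempty f).card_pos
  rw [mean, norm_smul, mul_pow, norm_inv, Real.norm_natCast]
  calc _ ≤ ((M.adj f).card : ℝ)⁻¹ ^ 2 * ((M.adj f).card * ∑ i ∈ M.adj f, ‖a i‖ ^ 2) := by
        gcongr
        exact (pow_le_pow_left₀ (norm_nonneg _) (norm_sum_le _ _) 2).trans sq_sum_le_card_mul_sum_sq
    _ = _ := by field_simp

/-- Estimates for the faces of each element, weighted with `q`, sum up to an estimate for the
averages on all faces, weighted with the average of `q`. -/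
lemma sum_inv_mean_mul_integral_le {V : Type} [NormedAddCommGroup V] [InnerProductSpace ℝ V]
    [SecondCountableTopologyEither (E d) V] [∀ f, IsFiniteMeasure (M.faceMeasure f)]
    {g : Fin M.numElems → E d → V} (hg : ∀ i, Continuous (g i)) {q J : Fin M.numElems → ℝ}
    (hq : ∀ i, 0 < q i)
    (hJ : ∀ i, ∑ f ∈ M.facesOf i, ∫ x, ‖g i x‖ ^ 2 ∂(M.faceMeasure f) ≤ q i * J i) :
    ∑ f, (M.mean f q)⁻¹ * ∫ x, ‖M.mean f fun i => g i x‖ ^ 2 ∂(M.faceMeasure f) ≤ ∑ i, J i := by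
  set b : Fin M.numFaces → Fin M.numElems → ℝ :=
    fun f i => ∫ x, ‖g i x‖ ^ 2 ∂(M.faceMeasure f) with hb
  have hb0 : ∀ f i, 0 ≤ b f i := fun f i => integral_nonneg fun x => sq_nonneg _
  have hface : ∀ f, (M.mean f q)⁻¹ * ∫ x, ‖M.mean f fun i => g i x‖ ^ 2 ∂(M.faceMeasure f) ≤
      ∑ i ∈ M.adj f, (q i)⁻¹ * b f i := by
    intro f
    have hn : (0 : ℝ) < (M.adj f).card := Nat.cast_pos.2 (M.adj_nonempty f).card_pos
    have hint : ∀ i, Integrable (fun x => ‖g i x‖ ^ 2) (M.faceMeasure f) := fun i =>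
      (M.memLp_faceMeasure_of_continuous f (hg i)).integrable_norm_pow (p := 2) two_ne_zero
    have h1 : ∫ x, ‖M.mean f fun i => g i x‖ ^ 2 ∂(M.faceMeasure f) ≤
        ((M.adj f).card : ℝ)⁻¹ * ∑ i ∈ M.adj f, b f i := by
      rw [← integral_finsetSum _ fun i _ => hint i, ← integral_const_mul]
      exact integral_mono ((M.memLp_faceMeasure_of_continuous f
          (M.continuous_mean hg f)).integrable_norm_pow (p := 2) two_ne_zero)
        ((integrable_finsetSum _ fun i _ => hint i).const_mul _) fun x => M.norm_sq_mean_le f _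
    have hS : 0 < ∑ i ∈ M.adj f, q i := Finset.sum_pos (fun i _ => hq i) (M.adj_nonempty f)
    calc _ ≤ (M.mean f q)⁻¹ * (((M.adj f).card : ℝ)⁻¹ * ∑ i ∈ M.adj f, b f i) :=
          mul_le_mul_of_nonneg_left h1 (inv_nonneg.2 (M.mean_pos f hq).le)
      _ = ∑ i ∈ M.adj f, (∑ j ∈ M.adj f, q j)⁻¹ * b f i := by
          rw [mean, smul_eq_mul, ← Finset.mul_sum]
          field_simp
      _ ≤ _ := by
          refine Finset.sum_le_sum fun i hi => mul_le_mul_of_nonneg_right ?_ (hb0 f i)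
          -- The number of adjacent elements has cancelled between the two averages, leaving `(∑
          -- q)⁻¹ ≤ (q i)⁻¹`.
          exact inv_anti₀ (hq i) (Finset.single_le_sum (fun j _ => (hq j).le) hi)
  calc _ ≤ ∑ f, ∑ i ∈ M.adj f, (q i)⁻¹ * b f i := Finset.sum_le_sum fun f _ => hface f
    _ = ∑ i, ∑ f ∈ M.facesOf i, (q i)⁻¹ * b f i :=
        Finset.sum_comm' fun f i => by simp [M.mem_adj, M.mem_facesOf]
    _ ≤ _ := Finset.sum_le_sum fun i _ => by
        rw [← Finset.mul_sum, inv_mul_le_iff₀ (hq i)]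
        exact hJ i

/-- The constant of the inverse estimates for the projected Laplacian. -/
def inverseConst (d : ℕ) (Cs : ℝ) : ℝ :=
  16 * (2 ^ d + 1) * (Cs * d) + (2 ^ (d + 1)) ^ 2 * (16 * (2 ^ d + 1)) * (Cs * d) ^ 3

lemma exists_projLaplacian_eval_eq {p : Fin M.numElems → ℕ} (hp : ∀ i, p i ≤ 3) (v : E d → ℝ)
    (i : Fin M.numElems) : ∃ (c : ℝ) (a : E d),
    (∀ x : E d, MvPolynomial.eval (fun j => x j) (M.projLaplacian p v i) = c + inner ℝ a x) ∧
    ∀ x : E d, (WithLp.toLp 2 fun l => MvPolynomial.eval (fun j => x j)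
      (MvPolynomial.pderiv l (M.projLaplacian p v i)) : E d) = a := by
  refine exists_eval_eq_const_add_inner
    (((MvPolynomial.mem_restrictTotalDegree _ _ _).1 (M.degreeLE_projLaplacian p v i)).trans ?_)
  have := hp i
  change p i - 2 ≤ 1
  omega

lemma continuous_evalGrad (P : MvPolynomial (Fin d) ℝ) :
    Continuous fun x : E d => (WithLp.toLp 2 fun l => MvPolynomial.eval (fun j => x j)
      (MvPolynomial.pderiv l P) : E d) :=
  (PiLp.continuous_toLp 2 _).comp (continuous_pi fun _ => continuous_eval _)

lemma memLp_meanPoly (f : Fin M.numFaces) [IsFiniteMeasure (M.faceMeasure f)]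
    (P : Fin M.numElems → MvPolynomial (Fin d) ℝ) : MemLp (M.meanPoly f P) 2 (M.faceMeasure f) :=
  M.memLp_faceMeasure_of_continuous f (M.continuous_mean (fun _ => continuous_eval _) f)

lemma memLp_meanGradPoly (f : Fin M.numFaces) [IsFiniteMeasure (M.faceMeasure f)]
    (P : Fin M.numElems → MvPolynomial (Fin d) ℝ) :
    MemLp (M.meanGradPoly f P) 2 (M.faceMeasure f) :=
  M.memLp_faceMeasure_of_continuous f (M.continuous_mean (fun _ => continuous_evalGrad _) f)

/-- The first inverse estimate with `h⁻¹ ≤ q`, combined with the contraction property of the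
projection. The `1/16` is what the later absorption uses. -/
lemma sum_inv_tau_mul_integral_meanPoly_le {Cs : ℝ} (hA : M.ArbitraryFaces Cs) (hCs : 0 < Cs)
    (hd : 2 ≤ d) {p : Fin M.numElems → ℕ} (hp : ∀ i, p i ≤ 3) {Cτ : ℝ}
    (hCτ : 16 * inverseConst d Cs ≤ Cτ) (v : E d → ℝ) :
    ∑ f, (M.tau p Cτ f)⁻¹ * ∫ x, M.meanPoly f (M.projLaplacian p v) x ^ 2 ∂(M.faceMeasure f) ≤
      (∑ i, ∫ x in M.elem i, weakLaplacian (M.elem i) v x ^ 2) / 16 := by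
  have hd0 : 0 < d := by omega
  have := hA.isFiniteMeasure_faceMeasure hd0
  have hK : 0 < inverseConst d Cs := by unfold inverseConst; positivity
  have hCτ0 : 0 < Cτ := by linarith
  have hmain := M.sum_inv_mean_mul_integral_le
    (g := fun i x => MvPolynomial.eval (fun j => x j) (M.projLaplacian p v i))
    (fun i => continuous_eval _) (q := fun i => M.ratio p i) (fun i => M.ratio_pos hd0 p i)
    (J := fun i => inverseConst d Cs * ∫ x in M.elem i, weakLaplacian (M.elem i) v x ^ 2) ?_
  · rw [← Finset.mul_sum] at hmain
    simp only [Real.norm_eq_abs, sq_abs] at hmain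
    simp only [tau, mul_inv, mul_assoc]
    rw [← Finset.mul_sum, inv_mul_le_iff₀ hCτ0]
    have hD : 0 ≤ ∑ i, ∫ x in M.elem i, weakLaplacian (M.elem i) v x ^ 2 :=
      Finset.sum_nonneg fun i _ => integral_nonneg fun x => sq_nonneg _
    have := mul_le_mul_of_nonneg_right hCτ hD
    unfold meanPoly
    linarith
  · intro i
    have hL := M.integral_sq_projLaplacian_le p v i
    obtain ⟨c, a, hP, -⟩ := exists_projLaplacian_eval_eq M hp v i
    simp only [hP] at hL ⊢
    obtain ⟨m, hm, hsum⟩ := hA.h_mul_sum_faceArea_mul_sq_le hCs hd0 i c a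
    have hh := M.h_pos hd0 i
    have h1 : ∀ f ∈ M.facesOf i, ∫ x, ‖c + inner ℝ a x‖ ^ 2 ∂(M.faceMeasure f) ≤
        M.faceArea f * m f ^ 2 := by
      intro f hf
      have := norm_setIntegral_le_of_norm_le_const (μ := (μHE[d - 1] : Measure (E d)))
        (f := fun x => ‖c + inner ℝ a x‖ ^ 2) (C := m f ^ 2)
        (hA.faceMeasure_ne_top hd0 hf).lt_top (fun x hx => by
          rw [norm_pow, norm_norm]
          exact pow_le_pow_left₀ (norm_nonneg _)
            (hm f hf x ((M.face f).interior_subset_closedInterior hx)) 2)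
      rw [mul_comm]
      exact (le_abs_self _).trans this
    have hI0 : 0 ≤ ∫ x in M.elem i, (c + inner ℝ a x) ^ 2 := integral_nonneg fun x => sq_nonneg _
    have hconst : 16 * (2 ^ d + 1) * (Cs * d) ≤ inverseConst d Cs := by
      unfold inverseConst
      exact le_add_of_nonneg_right (by positivity)
    calc _ ≤ ∑ f ∈ M.facesOf i, M.faceArea f * m f ^ 2 := Finset.sum_le_sum h1
      _ ≤ (M.h i)⁻¹ * (16 * (2 ^ d + 1) * (Cs * d) * ∫ x in M.elem i, (c + inner ℝ a x) ^ 2) := by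
          rwa [le_inv_mul_iff₀ hh]
      _ ≤ _ := by
          have := (M.ratio_pos hd0 p i).le
          gcongr
          exact M.inv_h_le_ratio hd0 p i

/-- The second inverse estimate; its scaling `h⁻³ ≤ q³` matches the cubic weight in `σ`. -/
lemma sum_inv_sigma_mul_integral_meanGradPoly_le {Cs : ℝ} (hA : M.ArbitraryFaces Cs)
    (hCs : 0 < Cs) (hd : 2 ≤ d) {p : Fin M.numElems → ℕ} (hp : ∀ i, p i ≤ 3) {Cσ : ℝ}
    (hCσ : 16 * inverseConst d Cs ≤ Cσ) (v : E d → ℝ) :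
    ∑ f, (M.sigma p Cσ f)⁻¹ *
        ∫ x, ‖M.meanGradPoly f (M.projLaplacian p v) x‖ ^ 2 ∂(M.faceMeasure f) ≤
      (∑ i, ∫ x in M.elem i, weakLaplacian (M.elem i) v x ^ 2) / 16 := by
  have hd0 : 0 < d := by omega
  have := hA.isFiniteMeasure_faceMeasure hd0
  have hK : 0 < inverseConst d Cs := by unfold inverseConst; positivity
  have hCσ0 : 0 < Cσ := by linarith
  have hmain := M.sum_inv_mean_mul_integral_le
    (g := fun i x => (WithLp.toLp 2 fun l => MvPolynomial.eval (fun j => x j)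
      (MvPolynomial.pderiv l (M.projLaplacian p v i)) : E d))
    (fun i => continuous_evalGrad _) (q := fun i => M.ratio p i ^ 3)
    (fun i => pow_pos (M.ratio_pos hd0 p i) 3)
    (J := fun i => inverseConst d Cs * ∫ x in M.elem i, weakLaplacian (M.elem i) v x ^ 2) ?_
  · rw [← Finset.mul_sum] at hmain
    simp only [sigma, mul_inv, mul_assoc]
    rw [← Finset.mul_sum, inv_mul_le_iff₀ hCσ0]
    have hD : 0 ≤ ∑ i, ∫ x in M.elem i, weakLaplacian (M.elem i) v x ^ 2 :=
      Finset.sum_nonneg fun i _ => integral_nonneg fun x => sq_nonneg _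
    have := mul_le_mul_of_nonneg_right hCσ hD
    unfold meanGradPoly
    linarith
  · intro i
    have hL := M.integral_sq_projLaplacian_le p v i
    obtain ⟨c, a, hP, hG⟩ := exists_projLaplacian_eval_eq M hp v i
    simp only [hP] at hL
    simp only [hG]
    have hsum := hA.h_pow_mul_norm_sq_mul_sum_faceArea_le hCs hd i c a
    have hh := M.h_pos hd0 i
    have h1 : ∀ f ∈ M.facesOf i, ∫ _, ‖a‖ ^ 2 ∂(M.faceMeasure f) = M.faceArea f * ‖a‖ ^ 2 := by
      intro f hf
      rw [faceMeasure, setIntegral_const, smul_eq_mul, faceArea]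
    have hI0 : 0 ≤ ∫ x in M.elem i, (c + inner ℝ a x) ^ 2 := integral_nonneg fun x => sq_nonneg _
    have hconst : (2 ^ (d + 1)) ^ 2 * (16 * (2 ^ d + 1)) * (Cs * d) ^ 3 ≤ inverseConst d Cs := by
      unfold inverseConst
      exact le_add_of_nonneg_left (by positivity)
    calc _ = ∑ f ∈ M.facesOf i, M.faceArea f * ‖a‖ ^ 2 := Finset.sum_congr rfl h1
      _ ≤ (M.h i ^ 3)⁻¹ * ((2 ^ (d + 1)) ^ 2 * (16 * (2 ^ d + 1)) * (Cs * d) ^ 3 *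
            ∫ x in M.elem i, (c + inner ℝ a x) ^ 2) := by
          rwa [le_inv_mul_iff₀ (pow_pos hh 3)]
      _ ≤ _ := by
          rw [← inv_pow]
          have := (M.ratio_pos hd0 p i).le
          gcongr
          exact M.inv_h_le_ratio hd0 p i

/-! ### The bilinear form -/

lemma dgNorm_sq {σ τ : Fin M.numFaces → ℝ} (hσ : ∀ f, 0 ≤ σ f) (hτ : ∀ f, 0 ≤ τ f)
    (v : E d → ℝ) :
    M.dgNorm σ τ v ^ 2 = (∑ i, ∫ x in M.elem i, weakLaplacian (M.elem i) v x ^ 2) +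
      ((∑ f, σ f * ∫ x, ‖M.jump f v x‖ ^ 2 ∂(M.faceMeasure f)) +
        ∑ f, τ f * ∫ x, M.gradJump f v x ^ 2 ∂(M.faceMeasure f)) := by
  rw [dgNorm, Real.sq_sqrt]
  · rw [← Finset.sum_add_distrib]
    congr 1
    refine Finset.sum_congr rfl fun f _ => ?_
    rw [← integral_const_mul, ← integral_const_mul, integral_add]
    · exact ((M.memLp_jump f v).integrable_norm_pow (p := 2) two_ne_zero).const_mul _
    · exact (M.memLp_gradJump f v).integrable_sq.const_mul _
  · refine add_nonneg (Finset.sum_nonneg fun i _ => integral_nonneg fun x => sq_nonneg _)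
      (Finset.sum_nonneg fun f _ => integral_nonneg fun x => ?_)
    have := hσ f
    have := hτ f
    positivity

lemma Btilde_eq [∀ f, IsFiniteMeasure (M.faceMeasure f)] (p : Fin M.numElems → ℕ)
    (σ τ : Fin M.numFaces → ℝ) (u v : E d → ℝ) :
    M.Btilde p σ τ u v =
      (∑ i, ∫ x in M.elem i, weakLaplacian (M.elem i) u x * weakLaplacian (M.elem i) v x) +
      ∑ f, ((∫ x, inner ℝ (M.meanGradPoly f (M.projLaplacian p u) x) (M.jump f v x)
            ∂(M.faceMeasure f)) +
        (∫ x, inner ℝ (M.meanGradPoly f (M.projLaplacian p v) x) (M.jump f u x)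
            ∂(M.faceMeasure f)) -
        (∫ x, M.meanPoly f (M.projLaplacian p u) x * M.gradJump f v x ∂(M.faceMeasure f)) -
        (∫ x, M.meanPoly f (M.projLaplacian p v) x * M.gradJump f u x ∂(M.faceMeasure f)) +
        σ f * (∫ x, inner ℝ (M.jump f u x) (M.jump f v x) ∂(M.faceMeasure f)) +
        τ f * ∫ x, M.gradJump f u x * M.gradJump f v x ∂(M.faceMeasure f)) := by
  rw [Btilde, add_sub_assoc, add_assoc, ← Finset.sum_sub_distrib, ← Finset.sum_add_distrib]
  congr 1
  refine Finset.sum_congr rfl fun f _ => ?_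
  have hP := fun v => M.memLp_meanPoly f (M.projLaplacian p v)
  have hG := fun v => M.memLp_meanGradPoly f (M.projLaplacian p v)
  have hj := M.memLp_jump f
  have hg := M.memLp_gradJump f
  have hPg : ∀ u v, Integrable (fun x => M.meanPoly f (M.projLaplacian p u) x * M.gradJump f v x)
      (M.faceMeasure f) := fun u v => (hP u).integrable_mul (hg v)
  have hgg : Integrable (fun x => M.gradJump f u x * M.gradJump f v x) (M.faceMeasure f) :=
    (hg u).integrable_mul (hg v)
  rw [integral_add (integrable_inner_of_memLp (hG u) (hj v))
      (integrable_inner_of_memLp (hG v) (hj u)),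
    integral_add (hPg u v) (hPg v u),
    integral_add ((integrable_inner_of_memLp (hj u) (hj v)).const_mul _)
      (hgg.const_mul _), integral_const_mul, integral_const_mul]
  ring

variable {M} {σ τ : Fin M.numFaces → ℝ} {p : Fin M.numElems → ℕ}

/-- Coercivity, provided that the averages of the projected Laplacian and of its gradient are
controlled in the norms that are dual to the penalty terms. -/
lemma dgNorm_sq_le_Btilde [∀ f, IsFiniteMeasure (M.faceMeasure f)] (hσ : ∀ f, 0 < σ f)
    (hτ : ∀ f, 0 < τ f) (v : E d → ℝ)
    (hG : ∑ f, (σ f)⁻¹ * ∫ x, ‖M.meanGradPoly f (M.projLaplacian p v) x‖ ^ 2 ∂(M.faceMeasure f) ≤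
      (∑ i, ∫ x in M.elem i, weakLaplacian (M.elem i) v x ^ 2) / 16)
    (hP : ∑ f, (τ f)⁻¹ * ∫ x, M.meanPoly f (M.projLaplacian p v) x ^ 2 ∂(M.faceMeasure f) ≤
      (∑ i, ∫ x in M.elem i, weakLaplacian (M.elem i) v x ^ 2) / 16) :
    1 / 2 * M.dgNorm σ τ v ^ 2 ≤ M.Btilde p σ τ v v := by
  rw [dgNorm_sq M (fun f => (hσ f).le) (fun f => (hτ f).le), M.Btilde_eq]
  simp only [real_inner_self_eq_norm_sq, ← sq]
  set D := ∑ i, ∫ x in M.elem i, weakLaplacian (M.elem i) v x ^ 2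
  have hD : 0 ≤ D := Finset.sum_nonneg fun i _ => integral_nonneg fun x => sq_nonneg _
  have hface := Finset.sum_le_sum fun f (_ : f ∈ Finset.univ) =>
    show 1 / 2 * (σ f * ∫ x, ‖M.jump f v x‖ ^ 2 ∂(M.faceMeasure f)) +
        1 / 2 * (τ f * ∫ x, M.gradJump f v x ^ 2 ∂(M.faceMeasure f)) -
        2 * ((σ f)⁻¹ * ∫ x, ‖M.meanGradPoly f (M.projLaplacian p v) x‖ ^ 2 ∂(M.faceMeasure f)) -
        2 * ((τ f)⁻¹ * ∫ x, M.meanPoly f (M.projLaplacian p v) x ^ 2 ∂(M.faceMeasure f)) ≤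
      (∫ x, inner ℝ (M.meanGradPoly f (M.projLaplacian p v) x) (M.jump f v x)
          ∂(M.faceMeasure f)) +
        (∫ x, inner ℝ (M.meanGradPoly f (M.projLaplacian p v) x) (M.jump f v x)
          ∂(M.faceMeasure f)) -
        (∫ x, M.meanPoly f (M.projLaplacian p v) x * M.gradJump f v x ∂(M.faceMeasure f)) -
        (∫ x, M.meanPoly f (M.projLaplacian p v) x * M.gradJump f v x ∂(M.faceMeasure f)) +
        σ f * (∫ x, ‖M.jump f v x‖ ^ 2 ∂(M.faceMeasure f)) +
        τ f * ∫ x, M.gradJump f v x ^ 2 ∂(M.faceMeasure f) by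
    -- The weights `2/σ` and `2/τ` leave half of each penalty term. After summation the dual terms
    -- cost at most `2 · D/16 + 2 · D/16 = D/4`.
    have h1 := abs_integral_inner_le (M.memLp_meanGradPoly f (M.projLaplacian p v))
      (M.memLp_jump f v) (s := 2 * (σ f)⁻¹) (mul_pos two_pos (inv_pos.2 (hσ f)))
    have h2 := abs_integral_mul_le (M.memLp_meanPoly f (M.projLaplacian p v))
      (M.memLp_gradJump f v) (s := 2 * (τ f)⁻¹) (mul_pos two_pos (inv_pos.2 (hτ f)))
    rw [mul_inv, inv_inv] at h1 h2
    have h3 := (abs_le.1 h1).1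
    have h4 := (abs_le.1 h2).2
    linarith
  simp only [Finset.sum_sub_distrib, Finset.sum_add_distrib, ← Finset.mul_sum] at hface ⊢
  linarith

/-- Continuity, provided that the averages of the projected Laplacian and of its gradient are
controlled in the norms that are dual to the penalty terms. -/
lemma abs_Btilde_le [∀ f, IsFiniteMeasure (M.faceMeasure f)] (hσ : ∀ f, 0 < σ f)
    (hτ : ∀ f, 0 < τ f)
    (hG : ∀ v : E d → ℝ,
      ∑ f, (σ f)⁻¹ * ∫ x, ‖M.meanGradPoly f (M.projLaplacian p v) x‖ ^ 2 ∂(M.faceMeasure f) ≤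
        (∑ i, ∫ x in M.elem i, weakLaplacian (M.elem i) v x ^ 2) / 16)
    (hP : ∀ v : E d → ℝ,
      ∑ f, (τ f)⁻¹ * ∫ x, M.meanPoly f (M.projLaplacian p v) x ^ 2 ∂(M.faceMeasure f) ≤
        (∑ i, ∫ x in M.elem i, weakLaplacian (M.elem i) v x ^ 2) / 16) (u v : E d → ℝ) :
    |M.Btilde p σ τ u v| ≤ 2 * (M.dgNorm σ τ u * M.dgNorm σ τ v) := by
  refine le_two_mul_mul_of_forall_pos (Real.sqrt_nonneg _) (Real.sqrt_nonneg _) fun s hs => ?_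
  rw [dgNorm_sq M (fun f => (hσ f).le) (fun f => (hτ f).le),
    dgNorm_sq M (fun f => (hσ f).le) (fun f => (hτ f).le), M.Btilde_eq]
  have hs' : 0 < s⁻¹ := inv_pos.2 hs
  -- The factors `2` arise because each jump occurs twice: once against an average and once in the
  -- penalty term.
  let W (v : E d → ℝ) (f : Fin M.numFaces) : ℝ :=
    (σ f)⁻¹ * (∫ x, ‖M.meanGradPoly f (M.projLaplacian p v) x‖ ^ 2 ∂(M.faceMeasure f)) +
    (τ f)⁻¹ * (∫ x, M.meanPoly f (M.projLaplacian p v) x ^ 2 ∂(M.faceMeasure f)) +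
    2 * (σ f * ∫ x, ‖M.jump f v x‖ ^ 2 ∂(M.faceMeasure f)) +
    2 * (τ f * ∫ x, M.gradJump f v x ^ 2 ∂(M.faceMeasure f))
  have hvol : |∑ i, ∫ x in M.elem i, weakLaplacian (M.elem i) u x * weakLaplacian (M.elem i) v x| ≤
      (s * (∑ i, ∫ x in M.elem i, weakLaplacian (M.elem i) u x ^ 2) +
        s⁻¹ * ∑ i, ∫ x in M.elem i, weakLaplacian (M.elem i) v x ^ 2) / 2 := by
    refine (Finset.abs_sum_le_sum_abs _ _).trans ((Finset.sum_le_sum fun i _ =>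
      abs_integral_mul_le (memLp_weakLaplacian _ u) (memLp_weakLaplacian _ v) hs).trans_eq ?_)
    rw [← Finset.sum_div, Finset.sum_add_distrib, Finset.mul_sum, Finset.mul_sum]
  have hface : ∀ f,
      |(∫ x, inner ℝ (M.meanGradPoly f (M.projLaplacian p u) x) (M.jump f v x)
            ∂(M.faceMeasure f)) +
        (∫ x, inner ℝ (M.meanGradPoly f (M.projLaplacian p v) x) (M.jump f u x)
            ∂(M.faceMeasure f)) -
        (∫ x, M.meanPoly f (M.projLaplacian p u) x * M.gradJump f v x ∂(M.faceMeasure f)) -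
        (∫ x, M.meanPoly f (M.projLaplacian p v) x * M.gradJump f u x ∂(M.faceMeasure f)) +
        σ f * (∫ x, inner ℝ (M.jump f u x) (M.jump f v x) ∂(M.faceMeasure f)) +
        τ f * ∫ x, M.gradJump f u x * M.gradJump f v x ∂(M.faceMeasure f)| ≤
      (s * W u f + s⁻¹ * W v f) / 2 := by
    intro f
    have hG := fun v => M.memLp_meanGradPoly f (M.projLaplacian p v)
    have hP := fun v => M.memLp_meanPoly f (M.projLaplacian p v)
    have hσ' := inv_pos.2 (hσ f)
    have hτ' := inv_pos.2 (hτ f)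
    have h1 := abs_le.1 (abs_integral_inner_le (hG u) (M.memLp_jump f v) (mul_pos hs hσ'))
    have h2 := abs_le.1 (abs_integral_inner_le (hG v) (M.memLp_jump f u) (mul_pos hs' hσ'))
    have h3 := abs_le.1 (abs_integral_mul_le (hP u) (M.memLp_gradJump f v) (mul_pos hs hτ'))
    have h4 := abs_le.1 (abs_integral_mul_le (hP v) (M.memLp_gradJump f u) (mul_pos hs' hτ'))
    have h5 := abs_integral_inner_le (M.memLp_jump f u) (M.memLp_jump f v) hs
    have h6 := abs_integral_mul_le (M.memLp_gradJump f u) (M.memLp_gradJump f v) hs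
    have h5' := abs_le.1 ((abs_mul _ _).trans_le
      (mul_le_mul (abs_of_pos (hσ f)).le h5 (abs_nonneg _) (hσ f).le))
    have h6' := abs_le.1 ((abs_mul _ _).trans_le
      (mul_le_mul (abs_of_pos (hτ f)).le h6 (abs_nonneg _) (hτ f).le))
    simp only [mul_inv, inv_inv] at h1 h2 h3 h4
    simp only [W]
    rw [abs_le]
    constructor <;> linarith [h1.1, h1.2, h2.1, h2.2, h3.1, h3.2, h4.1, h4.2, h5'.1, h5'.2,
      h6'.1, h6'.2]
  have hsumW : ∀ v, ∑ f, W v f ≤ (∑ i, ∫ x in M.elem i, weakLaplacian (M.elem i) v x ^ 2) / 8 +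
      2 * ((∑ f, σ f * ∫ x, ‖M.jump f v x‖ ^ 2 ∂(M.faceMeasure f)) +
        ∑ f, τ f * ∫ x, M.gradJump f v x ^ 2 ∂(M.faceMeasure f)) := by
    intro v
    simp only [W, Finset.sum_add_distrib, ← Finset.mul_sum]
    linarith [hG v, hP v]
  have hD : ∀ v, 0 ≤ ∑ i, ∫ x in M.elem i, weakLaplacian (M.elem i) v x ^ 2 := fun v =>
    Finset.sum_nonneg fun i _ => integral_nonneg fun x => sq_nonneg _
  -- The Laplacian terms enter with total factor `(1 + 1/8) / 2 ≤ 1` and the jump terms with factor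
  -- `1`, so the sum is at most `s ‖u‖² + s⁻¹ ‖v‖²`.
  refine (abs_add_le _ _).trans ((add_le_add hvol ((Finset.abs_sum_le_sum_abs _ _).trans
    (Finset.sum_le_sum fun f _ => hface f))).trans ?_)
  rw [← Finset.sum_div, Finset.sum_add_distrib, ← Finset.mul_sum, ← Finset.mul_sum]
  have h1 := mul_le_mul_of_nonneg_left (hsumW u) hs.le
  have h2 := mul_le_mul_of_nonneg_left (hsumW v) hs'.le
  have h3 := mul_nonneg hs.le (hD u)
  have h4 := mul_nonneg hs'.le (hD v)
  linarith

end PolytopicMesh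

end DGBiharmonic

/-! ### Choice of the constants and conclusion. -/

theorem mainTheorem4 (d : ℕ) (hd : d = 2 ∨ d = 3) (Cs θ : ℝ) (hCs : 0 < Cs) (hθ : 1 < θ) :
    ∃ Cσ₀ : ℝ, 0 < Cσ₀ ∧ ∃ Cτ₀ : ℝ, 0 < Cτ₀ ∧
    ∃ Ccoer : ℝ, 0 < Ccoer ∧ ∃ Ccont : ℝ, 0 < Ccont ∧
      ∀ (M : DGBiharmonic.PolytopicMesh d) (p : Fin M.numElems → ℕ),
        (∀ i, p i = 2 ∨ p i = 3) → M.ArbitraryFaces Cs → M.BoundedVariation p θ →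
        ∀ Cσ Cτ : ℝ, Cσ₀ ≤ Cσ → Cτ₀ ≤ Cτ →
          (∀ v ∈ M.dgSpace p,
            Ccoer * M.dgNorm (M.sigma p Cσ) (M.tau p Cτ) v ^ 2
              ≤ M.Btilde p (M.sigma p Cσ) (M.tau p Cτ) v v) ∧
          (∀ w ∈ M.dgSpace p, ∀ v ∈ M.dgSpace p,
            |M.Btilde p (M.sigma p Cσ) (M.tau p Cτ) w v|
              ≤ Ccont * M.dgNorm (M.sigma p Cσ) (M.tau p Cτ) w
                * M.dgNorm (M.sigma p Cσ) (M.tau p Cτ) v) := by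
  have hd2 : 2 ≤ d := by omega
  have hd0 : 0 < d := by omega
  have hK : 0 < DGBiharmonic.PolytopicMesh.inverseConst d Cs := by
    unfold DGBiharmonic.PolytopicMesh.inverseConst; positivity
  refine ⟨16 * DGBiharmonic.PolytopicMesh.inverseConst d Cs, by positivity,
    16 * DGBiharmonic.PolytopicMesh.inverseConst d Cs, by positivity, 1 / 2, by norm_num,
    2, two_pos, fun M p hp hA _ Cσ Cτ hCσ hCτ => ?_⟩
  have hp3 : ∀ i, p i ≤ 3 := fun i => by have := hp i; omega
  have := hA.isFiniteMeasure_faceMeasure hd0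
  have hσ : ∀ f, 0 < M.sigma p Cσ f := fun f =>
    mul_pos (by linarith) (M.mean_pos f fun i => pow_pos (M.ratio_pos hd0 p i) 3)
  have hτ : ∀ f, 0 < M.tau p Cτ f := fun f =>
    mul_pos (by linarith) (M.mean_pos f fun i => M.ratio_pos hd0 p i)
  have hG := M.sum_inv_sigma_mul_integral_meanGradPoly_le hA hCs hd2 hp3 hCσ
  have hP := M.sum_inv_tau_mul_integral_meanPoly_le hA hCs hd2 hp3 hCτ
  refine ⟨fun v _ => DGBiharmonic.PolytopicMesh.dgNorm_sq_le_Btilde hσ hτ v (hG v) (hP v),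
    fun w _ v _ => ?_⟩
  rw [mul_assoc]
  exact DGBiharmonic.PolytopicMesh.abs_Btilde_le hσ hτ hG hP w v
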